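/- **Setting.** Let $\mathbb{R}^\infty=\bigsqcup_{k\ge 0}\mathbb{R}^k$ be the set of finite sequences of real numbers; subsets of $\mathbb{R}^\infty$ are called problems, and a set of reals is regarded as a problem consisting of sequences of length one. A *BSS machine* is a finite list of instructions labelled $0,\dots,N-1$ ($N$ is the stop label) working on real registers $x_0,x_1,x_2,\dots$ and two address registers $i,j\in\mathbb{N}$. On input $(y_1,\dots,y_k)\in\mathbb{R}^k$ it starts at label $0$ with $i=j=1$, $x_0=k$, $x_m=y_m$ for $1\le m\le k$ and all other registers $0$. Its instructions are: $x_s\leftarrow x_k\circ x_l$ with $\circ\in\{+,-,\times,\div\}$, or $x_s\leftarrow\alpha$ with a real constant $\alpha$, where in addition each of $i,j$ is kept, incremented by one, or reset to $0$ (a division by zero is undefined, and the machine then does not terminate); "if $x_0\ge 0$ goto $b$, else go to the next instruction"; and $x_i\leftarrow x_j$. It terminates when it reaches the stop label; its output is then $(z_1,\dots,z_k)$ if $x_0=k$ and $x_m=z_m$ for $1\le m\le k$. A *BSS oracle machine* with oracle $B\subseteq\mathbb{R}^\infty$ may also use instructions that branch according to whether the finite sequence stored from some register $s$ on (its length in $x_s$,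 its entries in $x_{s+1},x_{s+2},\dots$) belongs to $B$. A problem $A$ is *decidable* if some BSS machine terminates on every input in $\mathbb{R}^\infty$ with the value ($1$ or $0$) of the characteristic function of $A$ as output, and *semi-decidable* if some BSS machine terminates precisely on the inputs belonging to $A$. Write $A\preceq B$ if some BSS oracle machine with oracle $B$ decides $A$, and $A\prec B$ if $A\preceq B$ but $B\not\preceq A$. The *real Halting Problem* $\mathbb{H}$ is the set of all concatenations of a code $c_M\in\mathbb{R}^\infty$ of a BSS machine $M$ (without oracle) with an $x\in\mathbb{R}^\infty$ such that $M$ terminates on input $x$; here $c_M$ lists the number of instructions of $M$ and then, for each instruction, a block of seven reals that describes it (its type and its parameters, including its real constant). **Theorem.** Let $\mathbb{A}$ be the set of real numbers that are algebraic over $\mathbb{Q}$, and $\mathbb{T}=\mathbb{R}\setminus\mathbb{A}$. Then 1. $\mathbb{Q}\prec\mathbb{A}$, that is, $\mathbb{Q}\preceq\mathbb{A}$ and $\mathbb{A}\not\preceq\mathbb{Q}$; 2. there is no BSS oracle machine with oracle $\mathbb{Q}$ that terminates, among the inputs $x\in\mathbb{R}$, precisely on those in $\mathbb{T}$ (so $\mathbb{T}$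 is not semi-decidable relative to $\mathbb{Q}$); 3. $\mathbb{Q}$ is semi-decidable but not decidable, and its degree lies strictly between that of the decidable problems and that of the real Halting Problem: $\emptyset\prec\mathbb{Q}\prec\mathbb{H}$. -/

import Mathlib

namespace BSS

/-- Arithmetic operations of a real machine. -/
inductive Op
  | add
  | sub
  | mul
  | div

/-- The result of an arithmetic operation; division by zero is undefined. -/
noncomputable def Op.eval : Op → ℝ → ℝ → Option ℝ
  | .add, a, b => some (a + b)
  | .sub, a, b => some (a - b)
  | .mul, a, b => some (a * b)
  | .div, a, b => open Classical in if b = 0 then none else some (a / b)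

/-- What a computation instruction does to a copy register (an address). -/
inductive Upd
  | keep
  | incr
  | zero

def Upd.eval : Upd → ℕ → ℕ
  | .keep, n => n
  | .incr, n => n + 1
  | .zero, _ => 0

/-- Instructions of a real (oracle) machine with registers `x 0, x 1, …` and copy registers
`i, j`. Instructions are numbered from `0`.
* `arith o s k l u v`: `x s ← x k ∘ x l`, then `i`, `j` are updated by `u`, `v`;
* `const s α u v`: `x s ← α`, then `i`, `j` are updated by `u`, `v`;
* `branch b`: if `x 0 ≥ 0` goto `b`, else goto the next instruction;
* `copy`: `x i ← x j`;
* `oracle s b`: if the vector stored from register `s` on (see `Stores`) belongs to the oracle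
  set goto `b`, else goto the next instruction. -/
inductive Instr
  | arith (o : Op) (s k l : ℕ) (u v : Upd)
  | const (s : ℕ) (α : ℝ) (u v : Upd)
  | branch (b : ℕ)
  | copy
  | oracle (s b : ℕ)

/-- The jump target of an instruction, if there is one. -/
def Instr.target : Instr → Option ℕ
  | .branch b => some b
  | .oracle _ b => some b
  | _ => none

def Instr.IsOracle : Instr → Prop
  | .oracle _ _ => True
  | _ => False

/-- A real (oracle) machine: a finite list of instructions with labels `0, …, length - 1`; the
label `length` is the stop label. All jumps stay inside the set of labels. -/
structure Machine where
  prog : List Instr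
  target_le : ∀ I ∈ prog, ∀ b, I.target = some b → b ≤ prog.length

/-- A machine without oracle nodes, that is, an ordinary real machine. -/
def Machine.OracleFree (M : Machine) : Prop := ∀ I ∈ M.prog, ¬ I.IsOracle

/-- Configurations: current label, the two copy registers, the contents of the registers. -/
structure Config where
  label : ℕ
  i : ℕ
  j : ℕ
  x : ℕ → ℝ

/-- The vector `y` is stored in the registers `x` from register `s` on: `x s` contains its length
and `x (s + 1), x (s + 2), …` contain its entries. -/
def Stores (x : ℕ → ℝ) (s : ℕ) (y : List ℝ) : Prop :=
  x s = (y.length : ℝ) ∧ ∀ (k : ℕ) (h : k < y.length), x (s + 1 + k) = y[k]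

/-- Initial register contents on input `y`: `x 0` is the length of `y`, followed by the entries of
`y`; all other registers are `0`. -/
def inputRegs (y : List ℝ) : ℕ → ℝ
  | 0 => (y.length : ℝ)
  | k + 1 => y.getD k 0

/-- Initial configuration on input `y`. -/
def start (y : List ℝ) : Config := ⟨0, 1, 1, inputRegs y⟩

/-- The effect of one instruction, with oracle set `B`. -/
noncomputable def Instr.exec (B : Set (List ℝ)) (c : Config) : Instr → Option Config
  | .arith o s k l u v =>
      (o.eval (c.x k) (c.x l)).map fun r =>
        ⟨c.label + 1, u.eval c.i, v.eval c.j, Function.update c.x s r⟩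
  | .const s α u v => some ⟨c.label + 1, u.eval c.i, v.eval c.j, Function.update c.x s α⟩
  | .branch b => open Classical in
      some ⟨if 0 ≤ c.x 0 then b else c.label + 1, c.i, c.j, c.x⟩
  | .copy => some ⟨c.label + 1, c.i, c.j, Function.update c.x c.i (c.x c.j)⟩
  | .oracle s b => open Classical in
      some ⟨if ∃ y ∈ B, Stores c.x s y then b else c.label + 1, c.i, c.j, c.x⟩

/-- `c'` is the successor of the configuration `c`. There is none at the stop label, and none
after a division by zero (in which case the machine never reaches the stop label). -/
def Machine.Step (M : Machine) (B : Set (List ℝ)) (c c' : Config) : Prop :=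
  ∃ I : Instr, M.prog[c.label]? = some I ∧ I.exec B c = some c'

/-- On input `y` and with oracle `B`, the machine stops in the configuration `c`. -/
def Machine.StopsAt (M : Machine) (B : Set (List ℝ)) (y : List ℝ) (c : Config) : Prop :=
  Relation.ReflTransGen (M.Step B) (start y) c ∧ c.label = M.prog.length

/-- On input `y` and with oracle `B`, the machine terminates. -/
def Machine.Halts (M : Machine) (B : Set (List ℝ)) (y : List ℝ) : Prop :=
  ∃ c, M.StopsAt B y c

/-- On input `y` and with oracle `B`, the machine terminates with output `z`. -/
def Machine.Outputs (M : Machine) (B : Set (List ℝ)) (y z : List ℝ) : Prop :=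
  ∃ c, M.StopsAt B y c ∧ Stores c.x 0 z

/-- The characteristic function of a set of finite real sequences. -/
noncomputable def charFn (A : Set (List ℝ)) (y : List ℝ) : List ℝ :=
  open Classical in if y ∈ A then [1] else [0]

/-- `A ⪯ B`: some oracle machine decides `A`, on all finite real sequences, with oracle `B`. -/
def Reduces (A B : Set (List ℝ)) : Prop :=
  ∃ M : Machine, ∀ y, M.Outputs B y (charFn A y)

/-- `A ≺ B`: `A` is reducible to `B`, but `B` is not reducible to `A`. -/
def StrictlyReduces (A B : Set (List ℝ)) : Prop :=
  Reduces A B ∧ ¬ Reduces B A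

/-- `A` is decidable (without oracle). -/
def IsDecidable (A : Set (List ℝ)) : Prop :=
  ∃ M : Machine, M.OracleFree ∧ ∀ y, M.Outputs ∅ y (charFn A y)

/-- `A` is semi-decidable (without oracle). -/
def IsSemiDecidable (A : Set (List ℝ)) : Prop :=
  ∃ M : Machine, M.OracleFree ∧ ∀ y, M.Halts ∅ y ↔ y ∈ A

/-- `A` is semi-decidable with oracle `B` over the admissible input set `Y`: some oracle machine
terminates, among the inputs in `Y`, precisely on those in `A`. -/
def SemiDecidableIn (Y A B : Set (List ℝ)) : Prop :=
  ∃ M : Machine, ∀ y ∈ Y, M.Halts B y ↔ y ∈ A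

/-- A set of reals as a set of sequences of length one. -/
def lang (S : Set ℝ) : Set (List ℝ) := {y | ∃ x ∈ S, y = [x]}

/-- The rationals. -/
def rationals : Set (List ℝ) := lang (Set.range ((↑) : ℚ → ℝ))

/-- The real algebraic numbers. -/
def algebraics : Set (List ℝ) := lang {x | IsAlgebraic ℚ x}

/-- The real transcendental numbers. -/
def transcendentals : Set (List ℝ) := lang {x | Transcendental ℚ x}

def Op.code : Op → ℝ
  | .add => 0
  | .sub => 1
  | .mul => 2
  | .div => 3

def Upd.code : Upd → ℝ
  | .keep => 0
  | .incr => 1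
  | .zero => 2

/-- The code of an instruction: a vector of length seven. -/
def Instr.code : Instr → List ℝ
  | .arith o s k l u v => [0, o.code, s, k, l, u.code, v.code]
  | .const s α u v => [1, s, α, u.code, v.code, 0, 0]
  | .branch b => [2, b, 0, 0, 0, 0, 0]
  | .copy => [3, 0, 0, 0, 0, 0, 0]
  | .oracle s b => [4, s, b, 0, 0, 0, 0]

/-- The code of a machine: the number of its instructions, then their codes. -/
def Machine.code (M : Machine) : List ℝ :=
  (M.prog.length : ℝ) :: M.prog.flatMap Instr.code

/-- The real Halting Problem: given the code of an (ordinary) machine `M` followed by a vector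
`x`, does `M` terminate on input `x`? -/
def haltingProblem : Set (List ℝ) :=
  {y | ∃ (M : Machine) (x : List ℝ), M.OracleFree ∧ y = M.code ++ x ∧ M.Halts ∅ x}

theorem Op.code_injective : Function.Injective Op.code := by
  intro a b h
  cases a <;> cases b <;> simp_all [Op.code]

theorem Upd.code_injective : Function.Injective Upd.code := by
  intro a b h
  cases a <;> cases b <;> simp_all [Upd.code]

theorem Instr.code_injective : Function.Injective Instr.code := by
  intro a b h
  cases a <;> cases b <;>
    simp [Instr.code, Op.code_injective.eq_iff, Upd.code_injective.eq_iff] at h ⊢ <;> tauto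

theorem Instr.length_code (I : Instr) : I.code.length = 7 := by
  cases I <;> rfl

/-- The coding is injective and self-delimiting. -/
theorem Machine.code_append_inj {M M' : Machine} {x x' : List ℝ}
    (h : M.code ++ x = M'.code ++ x') : M = M' ∧ x = x' := by
  obtain ⟨p, hp⟩ := M
  obtain ⟨p', hp'⟩ := M'
  simp only [Machine.code, List.cons_append, List.cons.injEq, Nat.cast_inj] at h
  obtain ⟨hl, h⟩ := h
  have key : p = p' ∧ x = x' := by
    clear hp hp'
    induction p generalizing p' with
    | nil =>
      cases p' with
      | nil => simpa using h
      | cons b q' => simp at hl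
    | cons a q ih =>
      cases p' with
      | nil => simp at hl
      | cons b q' =>
        simp only [List.flatMap_cons, List.append_assoc] at h
        obtain ⟨h1, h2⟩ := List.append_inj h (by simp [Instr.length_code])
        obtain ⟨h3, h4⟩ := ih q' (by simpa using hl) h2
        exact ⟨by rw [Instr.code_injective h1, h3], h4⟩
  obtain ⟨rfl, rfl⟩ := key
  exact ⟨rfl, rfl⟩

theorem code_append_mem_haltingProblem {M : Machine} (hM : M.OracleFree) (x : List ℝ) :
    M.code ++ x ∈ haltingProblem ↔ M.Halts ∅ x := by
  constructor
  · rintro ⟨M', x', -, h, h'⟩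
    obtain ⟨rfl, rfl⟩ := Machine.code_append_inj h
    exact h'
  · exact fun h => ⟨M, x, hM, rfl, h⟩

end BSS

/-! Negative statements. Fix an oracle machine, let `E` be a field containing its constants (and a
fixed prefix of the input), and let `t` be transcendental over `E`. Along a terminating run on `t`,
every register holds a rational function over `E` evaluated at `t`, and only finitely many tests
occur. Signs and equalities with elements of `E` are the same at all points near `t`, since a
rational function over `E` takes a value in `E` at `t` only if it is constant. A query "is `f(t)`
rational?" is answered positively only if `f` is a rational constant; otherwise `f(a)` is irrational
for all algebraic `a` near `t` of sufficiently large degree (`exists_degree_bound_eval_ne`). Such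
`a` accumulate at `t` (`exists_isAlgebraic_degree_gt`), so some of them follow the path of `t`
(`exists_family_reach`) and the machine treats an algebraic number like a transcendental one.
Without oracle, nearby rational `a` serve equally well. The same argument covers ℍ, whose section at
the code of a machine semi-deciding 𝔸 is 𝔸.

Positive statements. One real constant can store an infinite sequence of integer polynomials, each
written as a Horner word in base 8 (`exists_stream`); no effectiveness of the sequence is needed. A
machine searches it for a polynomial vanishing at the input. If all polynomials in the list have
only rational roots, this semi-decides ℚ. For ℚ ⪯ 𝔸, the oracle first guarantees that the search
ends, and a bit stored with each polynomial tells whether its real roots are all rational or all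
irrational. ℚ ⪯ ℍ is one query about the semi-deciding machine. -/

/-! ### Algebraic numbers of large degree -/

/-- A real number which is algebraic over a number field has bounded degree over `ℚ`. -/
theorem natDegree_minpoly_rat_le (L : IntermediateField ℚ ℝ) [FiniteDimensional ℚ L] {a : ℝ}
    {g : Polynomial L} (hg : g ≠ 0) (ha : Polynomial.aeval a g = 0) :
    (minpoly ℚ a).natDegree ≤ Module.finrank ℚ L * g.natDegree := by
  have hint : IsIntegral L a := (show IsAlgebraic L a from ⟨g, hg, ha⟩).isIntegral
  let F := IntermediateField.adjoin L {a}
  have : FiniteDimensional L F := IntermediateField.adjoin.finiteDimensional hint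
  have : FiniteDimensional ℚ F := FiniteDimensional.trans ℚ L F
  have h1 : Module.finrank L F = (minpoly L a).natDegree :=
    IntermediateField.adjoin.finrank hint
  have h2 : (minpoly L a).natDegree ≤ g.natDegree :=
    Polynomial.natDegree_le_of_dvd (minpoly.dvd L a ha) hg
  have h3 : (minpoly ℚ (IntermediateField.AdjoinSimple.gen L a)).natDegree ≤
      Module.finrank ℚ F := minpoly.natDegree_le _
  have h4 : minpoly ℚ (algebraMap F ℝ (IntermediateField.AdjoinSimple.gen L a)) =
      minpoly ℚ (IntermediateField.AdjoinSimple.gen L a) :=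
    minpoly.algebraMap_eq (algebraMap F ℝ).injective _
  rw [IntermediateField.AdjoinSimple.algebraMap_gen] at h4
  rw [h4]
  calc _ ≤ _ := h3
    _ = Module.finrank ℚ L * Module.finrank L F := (Module.finrank_mul_finrank ℚ L F).symm
    _ ≤ _ := by rw [h1]; gcongr

open Polynomial in
/-- A real rational function which is not a rational constant takes no rational values at
algebraic numbers of large degree. -/
theorem exists_degree_bound_eval_ne {p q : ℝ[X]} (h : ∀ r : ℚ, p ≠ C (r : ℝ) * q) :
    ∃ N : ℕ, ∀ a : ℝ, IsAlgebraic ℚ a → N < (minpoly ℚ a).natDegree →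
      ∀ r : ℚ, p.eval a ≠ r * q.eval a := by
  classical
  let K := algebraicClosure ℚ ℝ
  let b := Module.Basis.ofVectorSpace K ℝ
  -- The coefficients may be transcendental over `ℚ`, so they are expanded in a `K`-basis of `ℝ`.
  -- Only finitely many coordinates occur; they generate a number field `L` chosen before `r`, which
  -- makes the bound uniform in `r`.
  let S : Set ℝ := ⋃ c ∈ Set.range p.coeff ∪ Set.range q.coeff,
    Set.range fun j => ((b.repr c j : K) : ℝ)
  have hSfin : S.Finite := by
    refine (p.finite_range_coeff.union q.finite_range_coeff).biUnion fun c _ => ?_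
    have := (b.repr c).finite_range.image ((↑) : K → ℝ)
    rwa [← Set.range_comp] at this
  have : Finite S := hSfin
  let L := IntermediateField.adjoin ℚ S
  have : FiniteDimensional ℚ L := by
    refine IntermediateField.finiteDimensional_adjoin fun x hx => ?_
    simp only [S, Set.mem_iUnion] at hx
    obtain ⟨c, -, j, rfl⟩ := hx
    exact (b.repr c j).2
  refine ⟨Module.finrank ℚ L * max p.natDegree q.natDegree, fun a ha hdeg r hr => ?_⟩
  set f := p - C (r : ℝ) * q with hf
  have hf0 : f ≠ 0 := sub_ne_zero.2 (h r)
  have hfa : f.eval a = 0 := by simp [hf, hr]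
  have hfd : f.natDegree ≤ max p.natDegree q.natDegree :=
    (natDegree_sub_le _ _).trans (max_le_max le_rfl (natDegree_C_mul_le _ _))
  obtain ⟨i, hi⟩ : ∃ i, f.coeff i ≠ 0 := by
    by_contra! h0
    exact hf0 (by ext i; simp [h0 i])
  obtain ⟨j, hj⟩ : ∃ j, b.repr (f.coeff i) j ≠ 0 := by
    by_contra! h0
    exact hi (b.repr.injective (by ext j; simp [h0 j]))
  have hmem : ∀ i, ((b.repr (f.coeff i) j : K) : ℝ) ∈ L := by
    intro i
    have hp : ((b.repr (p.coeff i) j : K) : ℝ) ∈ L := IntermediateField.subset_adjoin _ _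
      (Set.mem_biUnion (Or.inl ⟨i, rfl⟩) ⟨j, rfl⟩)
    have hq : ((b.repr (q.coeff i) j : K) : ℝ) ∈ L := IntermediateField.subset_adjoin _ _
      (Set.mem_biUnion (Or.inr ⟨i, rfl⟩) ⟨j, rfl⟩)
    have : f.coeff i = p.coeff i - (r : K) • q.coeff i := by
      simp only [hf, coeff_sub, coeff_C_mul]; rfl
    rw [this, map_sub, map_smul]
    simp only [Finsupp.coe_sub, Finsupp.coe_smul, Pi.sub_apply, Pi.smul_apply, smul_eq_mul]
    push_cast
    exact L.sub_mem hp (L.mul_mem (by exact_mod_cast L.algebraMap_mem r) hq)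
  -- The `j`-th coordinate map is `K`-linear and `a` lies in `K`, so taking coordinates of the
  -- coefficients of `f` keeps `a` as a root.
  let g : L[X] := ∑ k ∈ Finset.range (f.natDegree + 1), monomial k ⟨_, hmem k⟩
  have hgc : g.coeff i = ⟨_, hmem i⟩ := by
    have : i < f.natDegree + 1 := Nat.lt_succ_of_le (le_natDegree_of_ne_zero hi)
    simp [g, coeff_monomial, this]
  have hg0 : g ≠ 0 := by
    intro h0
    rw [h0] at hgc
    apply hj
    have := congrArg (fun x : L => (x : ℝ)) hgc
    simpa using this.symm
  have hgd : g.natDegree ≤ f.natDegree :=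
    natDegree_sum_le_of_forall_le _ _ fun k hk =>
      (natDegree_monomial_le _).trans (Nat.lt_succ_iff.1 (Finset.mem_range.1 hk))
  let aK : K := ⟨a, ha.isIntegral⟩
  have hga : aeval a g = 0 := by
    have h1 : aeval a g = ((b.repr (∑ k ∈ Finset.range (f.natDegree + 1),
        (aK ^ k) • f.coeff k) j : K) : ℝ) := by
      simp only [g, map_sum, map_smul, aeval_monomial, Finsupp.finsetSum_apply,
        Finsupp.smul_apply, smul_eq_mul]
      push_cast
      exact Finset.sum_congr rfl fun k _ => mul_comm _ _
    have h2 : ∑ k ∈ Finset.range (f.natDegree + 1), (aK ^ k) • f.coeff k = 0 := by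
      rw [← hfa, eval_eq_sum_range]
      exact Finset.sum_congr rfl fun k _ => mul_comm _ _
    rw [h1, h2]; simp
  have := natDegree_minpoly_rat_le L hg0 hga
  have h3 : Module.finrank ℚ L * g.natDegree ≤
      Module.finrank ℚ L * max p.natDegree q.natDegree := by gcongr; exact hgd.trans hfd
  omega

open Polynomial in
/-- Algebraic numbers of arbitrarily large degree are dense. -/
theorem exists_isAlgebraic_degree_gt {t ε : ℝ} (hε : 0 < ε) (N : ℕ) :
    ∃ a : ℝ, |a - t| < ε ∧ IsAlgebraic ℚ a ∧ N < (minpoly ℚ a).natDegree := by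
  obtain ⟨P, hNP, hP⟩ := Nat.exists_infinite_primes (N + 1)
  let w : ℝ := (2 : ℝ) ^ ((P : ℝ)⁻¹)
  have hw : w ^ P = 2 := Real.rpow_inv_natCast_pow (by norm_num) hP.ne_zero
  have hirr : Irreducible (X ^ P - C 2 : ℚ[X]) := by
    refine X_pow_sub_C_irreducible_of_prime hP fun b hb => ?_
    have hint : IsIntegral ℤ b := ⟨X ^ P - C 2, monic_X_pow_sub_C _ hP.ne_zero, by simp [hb]⟩
    obtain ⟨z, rfl⟩ := IsIntegrallyClosed.isIntegral_iff.1 hint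
    have hz : z ^ P = 2 := by
      rw [eq_intCast] at hb
      exact_mod_cast hb
    -- A rational `P`-th root of 2 would be an even integer, whence `4 ∣ 2`.
    have h2 : (2 : ℤ) ∣ z := Int.prime_two.dvd_of_dvd_pow (n := P) (by rw [hz])
    have h4 : (2 : ℤ) ^ 2 ∣ z ^ P := (pow_dvd_pow_of_dvd h2 2).trans (pow_dvd_pow z hP.two_le)
    rw [hz] at h4
    norm_num at h4
  have hmin : minpoly ℚ w = X ^ P - C 2 :=
    (minpoly.eq_of_irreducible_of_monic hirr (by simp [hw])
      (monic_X_pow_sub_C _ hP.ne_zero)).symm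
  have halg : IsAlgebraic ℚ w := ⟨_, hirr.ne_zero, by simp [hw]⟩
  -- Translation by a rational moves `w` close to `t` and keeps its degree.
  obtain ⟨s, hs1, hs2⟩ := exists_rat_btwn (show t - w < t - w + ε by linarith)
  refine ⟨w + algebraMap ℚ ℝ s, ?_, halg.add (isAlgebraic_algebraMap s), ?_⟩
  · rw [abs_lt]; constructor <;> simp <;> linarith
  · rw [minpoly.add_algebraMap, natDegree_comp, hmin, natDegree_X_sub_C, natDegree_X_pow_sub_C]
    omega
-- Computation paths at a generic point
namespace BSS

open Polynomial Filter Topology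

section Symbolic

variable {E : Subfield ℝ} {t : ℝ}

/-- The value at `a` of the rational function with numerator `f.1` and denominator `f.2`. -/
noncomputable def fracEval (f : E[X] × E[X]) (a : ℝ) : ℝ := aeval a f.1 / aeval a f.2

theorem aeval_ne_zero_of_transcendental (ht : Transcendental E t) {p : E[X]} (hp : p ≠ 0) :
    aeval t p ≠ 0 := fun h => hp (transcendental_iff.1 ht p h)

theorem eventually_aeval_ne_zero (ht : Transcendental E t) {p : E[X]} (hp : p ≠ 0) :
    ∀ᶠ a in 𝓝 t, aeval a p ≠ 0 :=
  (p.continuous_aeval.continuousAt (x := t)).eventually_ne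
    (aeval_ne_zero_of_transcendental ht hp)

/-- A nonzero numerator does not vanish at `t`, so the sign is locally constant; a zero numerator
gives the value 0 everywhere. -/
theorem eventually_fracEval_nonneg_iff (ht : Transcendental E t) {f : E[X] × E[X]}
    (hf : f.2 ≠ 0) : ∀ᶠ a in 𝓝 t, (0 ≤ fracEval f a ↔ 0 ≤ fracEval f t) := by
  by_cases h0 : f.1 = 0
  · simp [fracEval, h0]
  have hq := aeval_ne_zero_of_transcendental ht hf
  have hne : fracEval f t ≠ 0 := div_ne_zero (aeval_ne_zero_of_transcendental ht h0) hq
  have hc : ContinuousAt (fracEval f) t :=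
    (f.1.continuous_aeval.continuousAt).div f.2.continuous_aeval.continuousAt hq
  rcases hne.lt_or_gt with h | h
  · filter_upwards [hc.eventually_lt_const h] with a ha
    simp [ha.not_ge, h.not_ge]
  · filter_upwards [hc.eventually_const_lt h] with a ha
    simp [ha.le, h.le]

theorem fracEval_eq_iff (ht : Transcendental E t) {f : E[X] × E[X]} (hf : f.2 ≠ 0) (e : E) :
    fracEval f t = e ↔ f.1 = C e * f.2 := by
  have hq := aeval_ne_zero_of_transcendental ht hf
  rw [fracEval, div_eq_iff hq]
  constructor
  · intro h
    have := transcendental_iff.1 ht (f.1 - C e * f.2) (by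
      rw [map_sub, map_mul, aeval_C, h]; exact sub_self _)
    exact sub_eq_zero.1 this
  · intro h
    rw [h, map_mul, aeval_C]; rfl

/-- Transcendence turns equality at `t` into an identity of rational functions, valid wherever the
denominator is nonzero; inequality persists by continuity. -/
theorem eventually_fracEval_eq_iff (ht : Transcendental E t) {f : E[X] × E[X]}
    (hf : f.2 ≠ 0) (e : E) : ∀ᶠ a in 𝓝 t, (fracEval f a = e ↔ fracEval f t = e) := by
  by_cases h : f.1 = C e * f.2
  · filter_upwards [eventually_aeval_ne_zero ht hf] with a ha
    refine iff_of_true ?_ ((fracEval_eq_iff ht hf e).2 h)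
    rw [fracEval, h, map_mul, aeval_C, mul_div_assoc, div_self ha, mul_one]; rfl
  · have hq := aeval_ne_zero_of_transcendental ht hf
    have hc : ContinuousAt (fracEval f) t :=
      (f.1.continuous_aeval.continuousAt).div f.2.continuous_aeval.continuousAt hq
    have hne := mt (fracEval_eq_iff ht hf e).1 h
    filter_upwards [hc.eventually_ne hne] with a ha
    exact iff_of_false ha hne

/-- The filter of algebraic numbers close to `t` and of large degree over `ℚ`. -/
noncomputable def algebraicNhds (t : ℝ) : Filter ℝ :=
  𝓝 t ⊓ (𝓟 {a | IsAlgebraic ℚ a} ⊓ comap (fun a => (minpoly ℚ a).natDegree) atTop)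

instance algebraicNhds_neBot (t : ℝ) : (algebraicNhds t).NeBot := by
  refine ((Metric.nhds_basis_ball (x := t)).inf
    ((hasBasis_principal _).inf (atTop_basis.comap _))).neBot_iff.2 ?_
  rintro ⟨ε, _, N⟩ ⟨hε, -⟩
  obtain ⟨a, h1, h2, h3⟩ := exists_isAlgebraic_degree_gt (t := t) hε N
  exact ⟨a, by simpa [Real.dist_eq] using h1, h2, h3.le⟩

theorem algebraicNhds_le (t : ℝ) : algebraicNhds t ≤ 𝓝 t := inf_le_left

theorem eventually_isAlgebraic (t : ℝ) : ∀ᶠ a in algebraicNhds t, IsAlgebraic ℚ a :=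
  (inf_le_right.trans inf_le_left : algebraicNhds t ≤ _) (mem_principal_self _)

theorem eventually_degree_gt (t : ℝ) (N : ℕ) :
    ∀ᶠ a in algebraicNhds t, N < (minpoly ℚ a).natDegree :=
  (inf_le_right.trans inf_le_right : algebraicNhds t ≤ _)
    (preimage_mem_comap (Ioi_mem_atTop N))

/-- Nearness to `t` is not enough here, because a nonconstant function takes rational values
arbitrarily near `t`; the large degree of `a` excludes them. -/
theorem eventually_fracEval_rat_iff (ht : Transcendental E t) {f : E[X] × E[X]}
    (hf : f.2 ≠ 0) : ∀ᶠ a in algebraicNhds t,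
      ((∃ r : ℚ, fracEval f a = r) ↔ ∃ r : ℚ, fracEval f t = r) := by
  by_cases h : ∃ r : ℚ, fracEval f t = r
  · obtain ⟨r, hr⟩ := h
    have := eventually_fracEval_eq_iff ht hf (r : E)
    filter_upwards [this.filter_mono (algebraicNhds_le t)] with a ha
    push_cast at ha
    exact iff_of_true ⟨r, ha.2 hr⟩ ⟨r, hr⟩
  · have hne : ∀ r : ℚ, f.1.map (algebraMap E ℝ) ≠ C (r : ℝ) * f.2.map (algebraMap E ℝ) := by
      intro r hr
      refine h ⟨r, ?_⟩
      have := (fracEval_eq_iff ht hf (r : E)).2 (map_injective _ (algebraMap E ℝ).injective (by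
        rw [hr, Polynomial.map_mul, map_C]; simp))
      simpa using this
    obtain ⟨N, hN⟩ := exists_degree_bound_eval_ne hne
    filter_upwards [(eventually_aeval_ne_zero ht hf).filter_mono (algebraicNhds_le t),
      eventually_isAlgebraic t, eventually_degree_gt t N] with a h1 h2 h3
    refine iff_of_false ?_ h
    rintro ⟨r, hr⟩
    refine hN a h2 h3 r ?_
    rwa [fracEval, div_eq_iff h1, ← eval_map_algebraMap, ← eval_map_algebraMap] at hr

/-- Near `t`, in the sense of the filter `l`, oracle queries about rational functions over `E`
are answered as at `t`. -/
def OracleStable (E : Subfield ℝ) (t : ℝ) (l : Filter ℝ) (B : Set (List ℝ)) : Prop :=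
  ∀ F : ℕ → E[X] × E[X], (∀ n, (F n).2 ≠ 0) → ∀ s, ∀ᶠ a in l,
    ((∃ y ∈ B, Stores (fun n => fracEval (F n) a) s y) ↔
      ∃ y ∈ B, Stores (fun n => fracEval (F n) t) s y)

theorem oracleStable_empty (E : Subfield ℝ) (t : ℝ) (l : Filter ℝ) : OracleStable E t l ∅ := by
  intro F _ s
  simp

theorem exists_mem_rationals_stores_iff (x : ℕ → ℝ) (s : ℕ) :
    (∃ y ∈ rationals, Stores x s y) ↔ x s = 1 ∧ ∃ r : ℚ, x (s + 1) = r := by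
  constructor
  · rintro ⟨_, ⟨_, ⟨r, rfl⟩, rfl⟩, h1, h2⟩
    exact ⟨by simpa using h1, r, by simpa using h2 0⟩
  · rintro ⟨h1, r, hr⟩
    refine ⟨[(r : ℝ)], ⟨r, ⟨r, rfl⟩, rfl⟩, by simpa using h1, fun k hk => ?_⟩
    obtain rfl : k = 0 := by simpa using hk
    simpa using hr

theorem oracleStable_rationals (ht : Transcendental E t) :
    OracleStable E t (algebraicNhds t) rationals := by
  intro F hF s
  simp only [exists_mem_rationals_stores_iff]
  filter_upwards [(eventually_fracEval_eq_iff ht (hF s) 1).filter_mono (algebraicNhds_le t),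
    eventually_fracEval_rat_iff ht (hF (s + 1))] with a h1 h2
  push_cast at h1
  rw [h1, h2]

theorem update_fracEval (F : ℕ → E[X] × E[X]) (s : ℕ) (f : E[X] × E[X]) (a : ℝ) :
    (fun n => fracEval (Function.update F s f n) a) =
      Function.update (fun n => fracEval (F n) a) s (fracEval f a) := by
  funext n
  by_cases h : n = s
  · subst h; simp
  · simp [h]

theorem exists_fracEval_op (ht : Transcendental E t) {f g : E[X] × E[X]} (hf : f.2 ≠ 0)
    (hg : g.2 ≠ 0) (o : Op) {r : ℝ} (h : o.eval (fracEval f t) (fracEval g t) = some r) :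
    ∃ k : E[X] × E[X], k.2 ≠ 0 ∧
      ∀ᶠ a in 𝓝 t, o.eval (fracEval f a) (fracEval g a) = some (fracEval k a) := by
  have hf' := eventually_aeval_ne_zero ht hf
  have hg' := eventually_aeval_ne_zero ht hg
  cases o with
  | add =>
    refine ⟨(f.1 * g.2 + f.2 * g.1, f.2 * g.2), mul_ne_zero hf hg, ?_⟩
    filter_upwards [hf', hg'] with a h1 h2
    simp [Op.eval, fracEval, div_add_div _ _ h1 h2]
  | sub =>
    refine ⟨(f.1 * g.2 - f.2 * g.1, f.2 * g.2), mul_ne_zero hf hg, ?_⟩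
    filter_upwards [hf', hg'] with a h1 h2
    simp [Op.eval, fracEval, div_sub_div _ _ h1 h2]
  | mul =>
    refine ⟨(f.1 * g.1, f.2 * g.2), mul_ne_zero hf hg, ?_⟩
    filter_upwards with a
    simp [Op.eval, fracEval, div_mul_div_comm]
  | div =>
    -- The division is defined at `t`, so this numerator may serve as a denominator.
    have h0 : g.1 ≠ 0 := by
      intro h0
      simp [Op.eval, fracEval, h0] at h
    refine ⟨(f.1 * g.2, f.2 * g.1), mul_ne_zero hf h0, ?_⟩
    filter_upwards [hg', eventually_aeval_ne_zero ht h0] with a h1 h2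
    simp [Op.eval, fracEval, div_div_div_eq, h1, h2]

/-- All real constants of the machine lie in `E`. -/
def Machine.ConstsIn (M : Machine) (E : Subfield ℝ) : Prop :=
  ∀ s α u v, Instr.const s α u v ∈ M.prog → α ∈ E

/-- Apart from oracle queries, which `OracleStable` controls, a step depends on at most two
registers. Hence finitely many eventual conditions suffice although `F` is an infinite family. -/
theorem exists_family_step {M : Machine} (hM : M.ConstsIn E) (ht : Transcendental E t)
    {l : Filter ℝ} (hl : l ≤ 𝓝 t) {B : Set (List ℝ)} (hB : OracleStable E t l B)
    {F : ℕ → E[X] × E[X]} (hF : ∀ n, (F n).2 ≠ 0) {m i j : ℕ} {c' : Config}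
    (h : M.Step B ⟨m, i, j, fun n => fracEval (F n) t⟩ c') :
    ∃ F' : ℕ → E[X] × E[X], (∀ n, (F' n).2 ≠ 0) ∧ c'.x = (fun n => fracEval (F' n) t) ∧
      ∀ᶠ a in l, M.Step B ⟨m, i, j, fun n => fracEval (F n) a⟩
        ⟨c'.label, c'.i, c'.j, fun n => fracEval (F' n) a⟩ := by
  obtain ⟨I, hI, h⟩ := h
  have hupd : ∀ (s : ℕ) (f : E[X] × E[X]), f.2 ≠ 0 → ∀ n, (Function.update F s f n).2 ≠ 0 := by
    intro s f hf n
    by_cases hn : n = s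
    · subst hn; simpa using hf
    · simpa [hn] using hF n
  cases I with
  | arith o s k l' u v =>
    simp only [Instr.exec, Option.map_eq_some_iff] at h
    obtain ⟨r, hr, rfl⟩ := h
    obtain ⟨f, hf, hev⟩ := exists_fracEval_op ht (hF k) (hF l') o hr
    have hrt : r = fracEval f t := by
      have := hev.self_of_nhds
      rw [hr] at this
      exact Option.some.inj this
    refine ⟨Function.update F s f, hupd s f hf, by rw [update_fracEval, hrt], ?_⟩
    filter_upwards [hev.filter_mono hl] with a ha
    exact ⟨_, hI, by simp [Instr.exec, ha, update_fracEval]⟩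
  | const s α u v =>
    simp only [Instr.exec, Option.some.injEq] at h
    subst h
    have hα := hM _ _ _ _ (List.mem_of_getElem? hI)
    have hv : ∀ a, fracEval ((C ⟨α, hα⟩, 1) : E[X] × E[X]) a = α := fun a => by
      simp only [fracEval, aeval_C, map_one, div_one]; rfl
    refine ⟨Function.update F s (C ⟨α, hα⟩, 1), hupd _ _ one_ne_zero,
      by rw [update_fracEval, hv], Eventually.of_forall fun a => ?_⟩
    exact ⟨_, hI, by simp [Instr.exec, update_fracEval, hv]⟩
  | branch b =>
    simp only [Instr.exec, Option.some.injEq] at h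
    subst h
    refine ⟨F, hF, rfl, ?_⟩
    filter_upwards [(eventually_fracEval_nonneg_iff ht (hF 0)).filter_mono hl] with a ha
    exact ⟨_, hI, by simp [Instr.exec, ha]⟩
  | copy =>
    simp only [Instr.exec, Option.some.injEq] at h
    subst h
    refine ⟨Function.update F i (F j), hupd _ _ (hF j), by rw [update_fracEval],
      Eventually.of_forall fun a => ?_⟩
    exact ⟨_, hI, by simp [Instr.exec, update_fracEval]⟩
  | oracle s b =>
    simp only [Instr.exec, Option.some.injEq] at h
    subst h
    refine ⟨F, hF, rfl, ?_⟩
    filter_upwards [hB F hF s] with a ha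
    refine ⟨_, hI, ?_⟩
    simp only [Instr.exec]
    congr 2
    classical exact if_congr ha rfl rfl

theorem exists_family_reach {M : Machine} (hM : M.ConstsIn E) (ht : Transcendental E t)
    {l : Filter ℝ} (hl : l ≤ 𝓝 t) {B : Set (List ℝ)} (hB : OracleStable E t l B)
    {F : ℕ → E[X] × E[X]} (hF : ∀ n, (F n).2 ≠ 0) {m i j : ℕ} {c' : Config}
    (h : Relation.ReflTransGen (M.Step B) ⟨m, i, j, fun n => fracEval (F n) t⟩ c') :
    ∃ F' : ℕ → E[X] × E[X], (∀ n, (F' n).2 ≠ 0) ∧ c'.x = (fun n => fracEval (F' n) t) ∧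
      ∀ᶠ a in l, Relation.ReflTransGen (M.Step B) ⟨m, i, j, fun n => fracEval (F n) a⟩
        ⟨c'.label, c'.i, c'.j, fun n => fracEval (F' n) a⟩ := by
  induction h with
  | refl => exact ⟨F, hF, rfl, Eventually.of_forall fun a => .refl⟩
  | @tail c₁ c₂ _ hs ih =>
    obtain ⟨F₁, hF₁, hx, hev⟩ := ih
    obtain ⟨m₁, i₁, j₁, x₁⟩ := c₁
    simp only at hx hev
    subst hx
    obtain ⟨F₂, hF₂, hx₂, hev₂⟩ := exists_family_step hM ht hl hB hF₁ hs
    refine ⟨F₂, hF₂, hx₂, ?_⟩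
    filter_upwards [hev, hev₂] with a h1 h2
    exact h1.tail h2

/-- The prefix enters as constants and only the last entry varies. An empty prefix serves for ℚ, 𝔸
and 𝕋, a machine code for ℍ. -/
theorem exists_family_input (w : List ℝ) (hw : ∀ e ∈ w, e ∈ E) :
    ∃ F : ℕ → E[X] × E[X], (∀ n, (F n).2 ≠ 0) ∧
      ∀ a, start (w ++ [a]) = ⟨0, 1, 1, fun n => fracEval (F n) a⟩ := by
  let G : ℕ → E[X]
    | 0 => (w.length + 1 : ℕ)
    | k + 1 => if h : k < w.length then C ⟨w[k], hw _ (List.getElem_mem h)⟩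
        else if k = w.length then X else 0
  refine ⟨fun n => (G n, 1), fun n => one_ne_zero, fun a => ?_⟩
  simp only [start, fracEval, map_one, div_one, Config.mk.injEq, true_and]
  funext n
  cases n with
  | zero => simp [inputRegs, G]
  | succ k =>
    simp only [inputRegs, G]
    split_ifs with h1 h2
    · rw [aeval_C, List.getD_append _ _ _ _ h1, List.getD_eq_getElem _ _ h1]; rfl
    · simp [h2]
    · rw [List.getD_eq_default _ _ (by simp; omega)]; simp

/-- Along an oracle-stable filter, termination with output `[0]` at a generic point persists. -/
theorem eventually_outputs_zero {M : Machine} (hM : M.ConstsIn E) (ht : Transcendental E t)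
    {l : Filter ℝ} (hl : l ≤ 𝓝 t) {B : Set (List ℝ)} (hB : OracleStable E t l B)
    {w : List ℝ} (hw : ∀ e ∈ w, e ∈ E) (h : M.Outputs B (w ++ [t]) [0]) :
    ∀ᶠ a in l, M.Outputs B (w ++ [a]) [0] := by
  obtain ⟨F, hF, hstart⟩ := exists_family_input w hw
  obtain ⟨c, ⟨hreach, hlab⟩, h0, h1⟩ := h
  rw [hstart] at hreach
  obtain ⟨F', hF', hx, hev⟩ := exists_family_reach hM ht hl hB hF hreach
  have hx0 : fracEval (F' 0) t = 1 := by simpa [hx] using h0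
  have hx1 : fracEval (F' 1) t = 0 := by simpa [hx] using h1 0
  filter_upwards [hev, (eventually_fracEval_eq_iff ht (hF' 0) 1).filter_mono hl,
    (eventually_fracEval_eq_iff ht (hF' 1) 0).filter_mono hl] with a ha e0 e1
  push_cast at e0 e1
  refine ⟨⟨c.label, c.i, c.j, fun n => fracEval (F' n) a⟩, ⟨by rw [hstart]; exact ha, hlab⟩, by simpa using e0.2 hx0, fun k hk => ?_⟩
  obtain rfl : k = 0 := by simpa using hk
  simpa using e1.2 hx1

/-- Along an oracle-stable filter, termination at a generic point persists. -/
theorem eventually_halts {M : Machine} (hM : M.ConstsIn E) (ht : Transcendental E t)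
    {l : Filter ℝ} (hl : l ≤ 𝓝 t) {B : Set (List ℝ)} (hB : OracleStable E t l B)
    {w : List ℝ} (hw : ∀ e ∈ w, e ∈ E) (h : M.Halts B (w ++ [t])) :
    ∀ᶠ a in l, M.Halts B (w ++ [a]) := by
  obtain ⟨F, hF, hstart⟩ := exists_family_input w hw
  obtain ⟨c, hreach, hlab⟩ := h
  rw [hstart] at hreach
  obtain ⟨F', hF', -, hev⟩ := exists_family_reach hM ht hl hB hF hreach
  filter_upwards [hev] with a ha
  exact ⟨⟨c.label, c.i, c.j, fun n => fracEval (F' n) a⟩, by rw [hstart]; exact ha, hlab⟩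

end Symbolic

/-- For every machine and every list of parameters, some real number is transcendental over a
field that contains the constants of the machine and the parameters. -/
theorem exists_generic (M : Machine) (w : List ℝ) :
    ∃ (E : Subfield ℝ) (t : ℝ), M.ConstsIn E ∧ (∀ e ∈ w, e ∈ E) ∧ Transcendental E t := by
  let g : Instr → ℝ := fun I => match I with
    | .const _ α _ _ => α
    | _ => 0
  let S : Set ℝ := {e | e ∈ M.prog.map g ++ w}
  have hS : S.Countable := (List.finite_toSet _).countable
  let E := Subfield.closure S
  have : Countable E := by
    rw [← Cardinal.mk_le_aleph0_iff]
    exact (Subfield.cardinalMk_closure_le_max S).trans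
      (max_le (Cardinal.mk_le_aleph0_iff.2 hS) le_rfl)
  -- Only countably many reals are algebraic over a countable field.
  have hne : {x : ℝ | IsAlgebraic E x} ≠ Set.univ := fun h => by
    have := Algebraic.countable E ℝ
    rw [h] at this
    exact Set.not_countable_univ this
  obtain ⟨t, ht⟩ := (Set.ne_univ_iff_exists_notMem _).1 hne
  refine ⟨E, t, fun s α u v h => Subfield.subset_closure ?_,
    fun e he => Subfield.subset_closure ?_, ht⟩
  · exact List.mem_append_left _ (List.mem_map.2 ⟨_, h, rfl⟩)
  · exact List.mem_append_right _ he

theorem Transcendental.rat_of_subfield {E : Subfield ℝ} {t : ℝ} (ht : Transcendental E t) :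
    Transcendental ℚ t := fun h => ht (h.tower_top E)

end BSS
-- Determinism and single steps
namespace BSS

open Relation

section Execution

variable {M : Machine} {B : Set (List ℝ)} {m i j s k l b : ℕ} {x : ℕ → ℝ}

theorem Machine.step_rightUnique (M : Machine) (B : Set (List ℝ)) :
    Relator.RightUnique (M.Step B) := by
  rintro c c₁ c₂ ⟨I, hI, h⟩ ⟨J, hJ, h'⟩
  obtain rfl := Option.some.inj (hI.symm.trans hJ)
  exact Option.some.inj (h.symm.trans h')

theorem Machine.not_step_of_label_eq {c c' : Config} (h : c.label = M.prog.length) :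
    ¬ M.Step B c c' := by
  rintro ⟨I, hI, -⟩
  simp [h] at hI

theorem Machine.StopsAt.unique {y : List ℝ} {c c' : Config} (h : M.StopsAt B y c)
    (h' : M.StopsAt B y c') : c = c' := by
  rcases ReflTransGen.total_of_right_unique (M.step_rightUnique B) h.1 h'.1 with h1 | h1
  · rcases h1.cases_head with h2 | ⟨d, hd, -⟩
    · exact h2
    · exact absurd hd (M.not_step_of_label_eq h.2)
  · rcases h1.cases_head with h2 | ⟨d, hd, -⟩
    · exact h2.symm
    · exact absurd hd (M.not_step_of_label_eq h'.2)

theorem Machine.outputs_one_zero {y : List ℝ} (h : M.Outputs B y [1]) (h' : M.Outputs B y [0]) :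
    False := by
  obtain ⟨c, hc, -, h1⟩ := h
  obtain ⟨c', hc', -, h0⟩ := h'
  obtain rfl := hc.unique hc'
  have h1 := h1 0 (by simp)
  have h0 := h0 0 (by simp)
  simp_all

/-- A machine which forever returns to a set of configurations does not terminate. -/
theorem Machine.not_halts_of_recurrent {y : List ℝ} (V : Set Config)
    (hstart : ∃ v ∈ V, ReflTransGen (M.Step B) (start y) v)
    (hV : ∀ v ∈ V, ∃ v' ∈ V, TransGen (M.Step B) v v') : ¬ M.Halts B y := by
  rintro ⟨c, hc, hlab⟩
  -- Invariant of the run: `V` stays reachable, because by determinism each step is the first step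
  -- of the path towards `V`.
  have key : ∃ v ∈ V, ReflTransGen (M.Step B) c v := by
    clear hlab
    induction hc with
    | refl => exact hstart
    | @tail c₁ c₂ _ hs ih =>
      obtain ⟨v, hv, hr⟩ := ih
      rcases hr.cases_head with rfl | ⟨d, hd, hr⟩
      · obtain ⟨v', hv', ht⟩ := hV _ hv
        obtain ⟨d, hd, hr⟩ := TransGen.head'_iff.1 ht
        obtain rfl := M.step_rightUnique B hs hd
        exact ⟨v', hv', hr⟩
      · obtain rfl := M.step_rightUnique B hs hd
        exact ⟨v, hv, hr⟩
  obtain ⟨v, hv, hr⟩ := key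
  rcases hr.cases_head with rfl | ⟨d, hd, -⟩
  · obtain ⟨v', -, ht⟩ := hV _ hv
    obtain ⟨d, hd, -⟩ := TransGen.head'_iff.1 ht
    exact M.not_step_of_label_eq hlab hd
  · exact M.not_step_of_label_eq hlab hd

/-- `x s ← x k + x l` -/
abbrev Instr.add (s k l : ℕ) : Instr := .arith .add s k l .keep .keep
/-- `x s ← x k - x l` -/
abbrev Instr.sub (s k l : ℕ) : Instr := .arith .sub s k l .keep .keep
/-- `x s ← x k * x l` -/
abbrev Instr.mul (s k l : ℕ) : Instr := .arith .mul s k l .keep .keep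
/-- `x s ← α` -/
abbrev Instr.set (s : ℕ) (α : ℝ) : Instr := .const s α .keep .keep

theorem step_add (h : M.prog[m]? = some (.add s k l)) :
    M.Step B ⟨m, i, j, x⟩ ⟨m + 1, i, j, Function.update x s (x k + x l)⟩ := ⟨_, h, rfl⟩

theorem step_sub (h : M.prog[m]? = some (.sub s k l)) :
    M.Step B ⟨m, i, j, x⟩ ⟨m + 1, i, j, Function.update x s (x k - x l)⟩ := ⟨_, h, rfl⟩

theorem step_mul (h : M.prog[m]? = some (.mul s k l)) :
    M.Step B ⟨m, i, j, x⟩ ⟨m + 1, i, j, Function.update x s (x k * x l)⟩ := ⟨_, h, rfl⟩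

theorem step_set {α : ℝ} (h : M.prog[m]? = some (.set s α)) :
    M.Step B ⟨m, i, j, x⟩ ⟨m + 1, i, j, Function.update x s α⟩ := ⟨_, h, rfl⟩

theorem step_branch (h : M.prog[m]? = some (.branch b)) (hx : 0 ≤ x 0) :
    M.Step B ⟨m, i, j, x⟩ ⟨b, i, j, x⟩ := ⟨_, h, by simp [Instr.exec, hx]⟩

theorem step_branch_neg (h : M.prog[m]? = some (.branch b)) (hx : x 0 < 0) :
    M.Step B ⟨m, i, j, x⟩ ⟨m + 1, i, j, x⟩ := ⟨_, h, by simp [Instr.exec, hx.not_ge]⟩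

theorem step_oracle (h : M.prog[m]? = some (.oracle s b)) (hx : ∃ y ∈ B, Stores x s y) :
    M.Step B ⟨m, i, j, x⟩ ⟨b, i, j, x⟩ := ⟨_, h, by simp only [Instr.exec, if_pos hx]⟩

theorem step_oracle_neg (h : M.prog[m]? = some (.oracle s b)) (hx : ¬ ∃ y ∈ B, Stores x s y) :
    M.Step B ⟨m, i, j, x⟩ ⟨m + 1, i, j, x⟩ := ⟨_, h, by simp only [Instr.exec, if_neg hx]⟩

theorem stores_singleton {z : ℝ} (h0 : x 0 = 1) (h1 : x 1 = z) : Stores x 0 [z] := by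
  refine ⟨by simpa using h0, fun k hk => ?_⟩
  obtain rfl : k = 0 := by simpa using hk
  simpa using h1

end Execution

/-! ### Horner words and digit streams -/

/-- The steps of a Horner scheme with integer coefficients. -/
inductive HornerOp
  | mul
  | inc
  | dec

namespace HornerOp

def eval {R : Type*} [CommRing R] (x : R) : R → HornerOp → R
  | a, mul => a * x
  | a, inc => a + 1
  | a, dec => a - 1

def digit : HornerOp → ℝ
  | mul => 0
  | inc => 1
  | dec => 2

theorem digit_bounds (o : HornerOp) : 0 ≤ o.digit ∧ o.digit ≤ 2 := by
  cases o <;> norm_num [digit]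

end HornerOp

/-- The value at `x` of the polynomial built by the word `w`. -/
def hornerEval {R : Type*} [CommRing R] (w : List HornerOp) (x : R) : R :=
  w.foldl (HornerOp.eval x) 0

/-- Encodes the word `w`, a final test that outputs `b` and a remainder `t` as base `8` digits. -/
noncomputable def blockEncode (b : Bool) (t : ℝ) : List HornerOp → ℝ
  | [] => ((bif b then 3 else 4) + t) / 8
  | o :: w => (o.digit + blockEncode b t w) / 8

/-- Here `r` is `8 ^ -(w.length + 1)`. All digits are at most 4, and the geometric sum of `4 / 8 ^
k` over the block is `4 / 7 * (1 - r)`. -/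
theorem exists_blockEncode_eq (w : List HornerOp) (b : Bool) :
    ∃ a r : ℝ, (∀ t, blockEncode b t w = a + r * t) ∧
      0 ≤ a ∧ 0 ≤ r ∧ r ≤ 1 / 8 ∧ a ≤ 4 / 7 * (1 - r) := by
  induction w with
  | nil =>
    refine ⟨(bif b then 3 else 4) / 8, 1 / 8, fun t => by rw [blockEncode]; ring, ?_⟩
    cases b <;> norm_num
  | cons o w ih =>
    obtain ⟨a, r, h, h0, h1, h2, h3⟩ := ih
    have := o.digit_bounds
    refine ⟨(o.digit + a) / 8, r / 8, fun t => by rw [blockEncode, h]; ring, ?_, ?_, ?_, ?_⟩ <;>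
      linarith

/-- Unfolding the recursion forever gives a series with terms `u n k`. Its partial sums are bounded
by telescoping, each `a` using up at most the share `C * (1 - r)` of what remains. -/
theorem exists_seq_of_affine {a r : ℕ → ℝ} {C : ℝ} (ha : ∀ n, 0 ≤ a n) (hr : ∀ n, 0 ≤ r n)
    (hr' : ∀ n, r n ≤ 1 / 8) (hC : ∀ n, a n ≤ C * (1 - r n)) :
    ∃ T : ℕ → ℝ, ∀ n, T n = a n + r n * T (n + 1) ∧ 0 ≤ T n ∧ T n ≤ C := by
  let u : ℕ → ℕ → ℝ := fun n k => a (n + k) * ∏ i ∈ Finset.range k, r (n + i)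
  have hC0 : 0 ≤ C := by
    by_contra! h
    nlinarith [ha 0, hC 0, hr' 0]
  have hu0 : ∀ n k, 0 ≤ u n k := fun n k =>
    mul_nonneg (ha _) (Finset.prod_nonneg fun i _ => hr _)
  have hpart : ∀ n K, ∑ k ∈ Finset.range K, u n k ≤
      C * (1 - ∏ i ∈ Finset.range K, r (n + i)) := by
    intro n K
    induction K with
    | zero => simp
    | succ K ih =>
      rw [Finset.sum_range_succ, Finset.prod_range_succ]
      have hp : 0 ≤ ∏ i ∈ Finset.range K, r (n + i) := Finset.prod_nonneg fun i _ => hr _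
      have := mul_le_mul_of_nonneg_right (hC (n + K)) hp
      simp only [u]
      linarith
  have hpart' : ∀ n K, ∑ k ∈ Finset.range K, u n k ≤ C := fun n K =>
    (hpart n K).trans (by
      have hp : 0 ≤ ∏ i ∈ Finset.range K, r (n + i) := Finset.prod_nonneg fun i _ => hr _
      nlinarith)
  have hsum : ∀ n, Summable (u n) := fun n => summable_of_sum_range_le (hu0 n) (hpart' n)
  refine ⟨fun n => ∑' k, u n k, fun n => ⟨?_, tsum_nonneg (hu0 n),
    Real.tsum_le_of_sum_range_le (hu0 n) (hpart' n)⟩⟩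
  beta_reduce
  rw [(hsum n).tsum_eq_zero_add, ← tsum_mul_left]
  congr 1
  · simp [u]
  · refine tsum_congr fun k => ?_
    simp only [u]
    rw [Finset.prod_range_succ']
    simp only [add_zero, Nat.add_assoc, Nat.add_comm 1]
    ring

/-- Any sequence of words and outputs can be encoded in one real number. -/
theorem exists_stream (g : ℕ → List HornerOp × Bool) :
    ∃ T : ℕ → ℝ, ∀ n, T n = blockEncode (g n).2 (T (n + 1)) (g n).1 ∧ 0 ≤ T n ∧ T n < 1 := by
  choose a r h h0 h1 h2 h3 using fun n => exists_blockEncode_eq (g n).1 (g n).2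
  obtain ⟨T, hT⟩ := exists_seq_of_affine h0 h1 h2 h3
  exact ⟨T, fun n => ⟨by rw [h]; exact (hT n).1, (hT n).2.1, (hT n).2.2.trans_lt (by norm_num)⟩⟩

/-! ### The search machine -/

/-- The instructions of a machine that reads words and tests from the base `8` digits of `α`.
Register `1` holds the input, `2` the square of the length of the input minus one, `3` the current
value of the Horner scheme, `4` the remaining digits and `9` the output after a successful test. -/
noncomputable def searchProg (I₀ : Instr) (α : ℝ) : List Instr :=
  [I₀, .set 0 1, .set 1 0, .branch 47,
   .set 5 1, .sub 2 0 5, .mul 2 2 2, .set 3 0, .set 4 α, .set 6 8,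
   .mul 4 4 6, .sub 0 4 5, .branch 16, .mul 3 3 1, .set 0 0, .branch 10,
   .sub 4 4 5, .sub 0 4 5, .branch 22, .add 3 3 5, .set 0 0, .branch 10,
   .sub 4 4 5, .sub 0 4 5, .branch 28, .sub 3 3 5, .set 0 0, .branch 10,
   .sub 4 4 5, .sub 0 4 5, .branch 34, .set 9 1, .set 0 0, .branch 36,
   .sub 4 4 5, .set 9 0,
   .mul 7 3 3, .add 7 7 2, .set 3 0, .set 0 0, .sub 0 0 7, .branch 44, .set 0 0, .branch 10,
   .set 0 1, .set 1 0, .add 1 1 9]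

/-- `I₀` either starts the search at label 4 or falls through to output 0. Taking `.branch 4`, which
always jumps on an input, gives semi-decision; an oracle query gives the reduction. -/
noncomputable def searchMachine (I₀ : Instr) (h : I₀.target = some 4) (α : ℝ) : Machine where
  prog := searchProg I₀ α
  target_le := by
    intro I hI b hb
    simp only [searchProg, List.mem_cons, List.not_mem_nil, or_false] at hI
    rcases hI with rfl | hI
    · rw [h] at hb
      cases hb
      simp [searchProg]
    · rcases hI with rfl | rfl | rfl | rfl | rfl | rfl | rfl | rfl | rfl | rfl | rfl | rfl | rfl |
        rfl | rfl | rfl | rfl | rfl | rfl | rfl | rfl | rfl | rfl | rfl | rfl | rfl | rfl | rfl |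
        rfl | rfl | rfl | rfl | rfl | rfl | rfl | rfl | rfl | rfl | rfl | rfl | rfl | rfl | rfl |
        rfl | rfl | rfl <;> simp [Instr.target] at hb <;> subst hb <;> simp [searchProg]

/-- The register contents at the head of the main loop of the search machine. -/
structure LoopRegs (X κ a t : ℝ) (x : ℕ → ℝ) : Prop where
  h1 : x 1 = X
  h2 : x 2 = κ
  h3 : x 3 = a
  h4 : x 4 = t
  h5 : x 5 = 1
  h6 : x 6 = 8

section Search

variable {I₀ : Instr} {h₀ : I₀.target = some 4} {α : ℝ} {B : Set (List ℝ)} {i j : ℕ}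
  {X κ a t : ℝ} {x : ℕ → ℝ}

/-- Multiplication by 8 brings the digit before the point, and unit subtractions with sign tests
identify it. The tests are exact because `0 ≤ t < 1`. -/
theorem search_op (o : HornerOp) (hx : LoopRegs X κ a ((o.digit + t) / 8) x) (ht0 : 0 ≤ t)
    (ht1 : t < 1) : ∃ x', LoopRegs X κ (o.eval X a) t x' ∧
      ReflTransGen ((searchMachine I₀ h₀ α).Step B) ⟨10, i, j, x⟩ ⟨10, i, j, x'⟩ := by
  obtain ⟨h1, h2, h3, h4, h5, h6⟩ := hx
  cases o with
  | mul =>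
    simp only [HornerOp.digit, zero_add] at h4
    refine ⟨_, ?_, .head (step_mul rfl) <| .head (step_sub rfl) <|
      .head (step_branch_neg rfl ?_) <| .head (step_mul rfl) <| .head (step_set rfl) <|
      .head (step_branch rfl ?_) .refl⟩
    · constructor <;> simp [HornerOp.eval, *]
    · simp [*]
    · simp
  | inc =>
    simp only [HornerOp.digit] at h4
    refine ⟨_, ?_, .head (step_mul rfl) <| .head (step_sub rfl) <|
      .head (step_branch rfl ?_) <| .head (step_sub rfl) <| .head (step_sub rfl) <|
      .head (step_branch_neg rfl ?_) <| .head (step_add rfl) <| .head (step_set rfl) <|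
      .head (step_branch rfl ?_) .refl⟩
    · constructor <;> simp [HornerOp.eval, *]
    · simp [*]
    · simp [*]
    · simp
  | dec =>
    simp only [HornerOp.digit] at h4
    refine ⟨_, ?_, .head (step_mul rfl) <| .head (step_sub rfl) <|
      .head (step_branch rfl ?_) <| .head (step_sub rfl) <| .head (step_sub rfl) <|
      .head (step_branch rfl ?_) <| .head (step_sub rfl) <| .head (step_sub rfl) <|
      .head (step_branch_neg rfl ?_) <| .head (step_sub rfl) <| .head (step_set rfl) <|
      .head (step_branch rfl ?_) .refl⟩
    · constructor <;> simp [HornerOp.eval, *]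
      ring
    · simp [*]; linarith
    · simp [*]; linarith
    · simp [*]; linarith
    · simp

theorem search_test_digit (b : Bool) (hx : LoopRegs X κ a (((bif b then 3 else 4) + t) / 8) x)
    (ht0 : 0 ≤ t) (ht1 : t < 1) : ∃ x', LoopRegs X κ a t x' ∧ x' 9 = (bif b then 1 else 0) ∧
      ReflTransGen ((searchMachine I₀ h₀ α).Step B) ⟨10, i, j, x⟩ ⟨36, i, j, x'⟩ := by
  obtain ⟨h1, h2, h3, h4, h5, h6⟩ := hx
  cases b with
  | true =>
    simp only [cond_true] at h4
    refine ⟨_, ?_, ?_, .head (step_mul rfl) <| .head (step_sub rfl) <|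
      .head (step_branch rfl ?_) <| .head (step_sub rfl) <| .head (step_sub rfl) <|
      .head (step_branch rfl ?_) <| .head (step_sub rfl) <| .head (step_sub rfl) <|
      .head (step_branch rfl ?_) <| .head (step_sub rfl) <| .head (step_sub rfl) <|
      .head (step_branch_neg rfl ?_) <| .head (step_set rfl) <| .head (step_set rfl) <|
      .head (step_branch rfl ?_) .refl⟩
    · constructor <;> simp [*]
      ring
    · simp
    · simp [*]; linarith
    · simp [*]; linarith
    · simp [*]; linarith
    · simp [*]; linarith
    · simp
  | false =>
    simp only [cond_false] at h4
    refine ⟨_, ?_, ?_, .head (step_mul rfl) <| .head (step_sub rfl) <|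
      .head (step_branch rfl ?_) <| .head (step_sub rfl) <| .head (step_sub rfl) <|
      .head (step_branch rfl ?_) <| .head (step_sub rfl) <| .head (step_sub rfl) <|
      .head (step_branch rfl ?_) <| .head (step_sub rfl) <| .head (step_sub rfl) <|
      .head (step_branch rfl ?_) <| .head (step_sub rfl) <| .head (step_set rfl) .refl⟩
    · constructor <;> simp [*]
      ring
    · simp
    · simp [*]; linarith
    · simp [*]; linarith
    · simp [*]; linarith
    · simp [*]; linarith

/-- The tested register is `-(a * a + κ)`, nonnegative only if both squares vanish: one sign test
checks the root and the input length. -/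
theorem search_test_success {z : ℝ} (hx : LoopRegs X κ a t x) (h9 : x 9 = z)
    (h : a * a + κ = 0) : ∃ x', x' 0 = 1 ∧ x' 1 = z ∧
      ReflTransGen ((searchMachine I₀ h₀ α).Step B) ⟨36, i, j, x⟩ ⟨47, i, j, x'⟩ := by
  obtain ⟨h1, h2, h3, h4, h5, h6⟩ := hx
  refine ⟨_, ?_, ?_, .head (step_mul rfl) <| .head (step_add rfl) <| .head (step_set rfl) <|
    .head (step_set rfl) <| .head (step_sub rfl) <| .head (step_branch rfl ?_) <|
    .head (step_set rfl) <| .head (step_set rfl) <| .head (step_add rfl) .refl⟩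
  · simp
  · simp [*]
  · simp [*]

/-- `TransGen` records that at least one step is made, as the recurrence criterion for
nontermination requires. -/
theorem search_test_failure (hx : LoopRegs X κ a t x) (h : 0 < a * a + κ) :
    ∃ x', LoopRegs X κ 0 t x' ∧
      TransGen ((searchMachine I₀ h₀ α).Step B) ⟨36, i, j, x⟩ ⟨10, i, j, x'⟩ := by
  obtain ⟨h1, h2, h3, h4, h5, h6⟩ := hx
  refine ⟨_, ?_, .head' (step_mul rfl) <| .head (step_add rfl) <| .head (step_set rfl) <|
    .head (step_set rfl) <| .head (step_sub rfl) <| .head (step_branch_neg rfl ?_) <|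
    .head (step_set rfl) <| .head (step_branch rfl ?_) .refl⟩
  · constructor <;> simp [*]
  · simp [*]; linarith
  · simp

theorem blockEncode_bounds (b : Bool) (ht0 : 0 ≤ t) (ht1 : t < 1) (w : List HornerOp) :
    0 ≤ blockEncode b t w ∧ blockEncode b t w < 1 := by
  induction w with
  | nil => cases b <;> simp [blockEncode] <;> constructor <;> linarith
  | cons o w ih =>
    have := o.digit_bounds
    rw [blockEncode]
    constructor <;> linarith

theorem search_word (b : Bool) (ht0 : 0 ≤ t) (ht1 : t < 1) (w : List HornerOp)
    (hx : LoopRegs X κ a (blockEncode b t w) x) :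
    ∃ x', LoopRegs X κ (w.foldl (HornerOp.eval X) a) t x' ∧ x' 9 = (bif b then 1 else 0) ∧
      ReflTransGen ((searchMachine I₀ h₀ α).Step B) ⟨10, i, j, x⟩ ⟨36, i, j, x'⟩ := by
  induction w generalizing a x with
  | nil => exact search_test_digit b hx ht0 ht1
  | cons o w ih =>
    obtain ⟨h0, h1⟩ := blockEncode_bounds b ht0 ht1 w
    obtain ⟨x₁, hx₁, hr₁⟩ := search_op o hx h0 h1
    obtain ⟨x₂, hx₂, h9, hr₂⟩ := ih hx₁
    exact ⟨x₂, hx₂, h9, hr₁.trans hr₂⟩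

theorem search_init (x : ℕ → ℝ) : ∃ x', LoopRegs (x 1) ((x 0 - 1) * (x 0 - 1)) 0 α x' ∧
    ReflTransGen ((searchMachine I₀ h₀ α).Step B) ⟨4, i, j, x⟩ ⟨10, i, j, x'⟩ := by
  refine ⟨_, ?_, .head (step_set rfl) <| .head (step_sub rfl) <| .head (step_mul rfl) <|
    .head (step_set rfl) <| .head (step_set rfl) <| .head (step_set rfl) .refl⟩
  constructor <;> simp

variable {g : ℕ → List HornerOp × Bool} {T : ℕ → ℝ}

theorem search_loop_success
    (hT : ∀ n, T n = blockEncode (g n).2 (T (n + 1)) (g n).1 ∧ 0 ≤ T n ∧ T n < 1)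
    {n : ℕ} (hx : LoopRegs X κ 0 (T n) x)
    (h : hornerEval (g n).1 X * hornerEval (g n).1 X + κ = 0) :
    ∃ x', x' 0 = 1 ∧ x' 1 = (bif (g n).2 then 1 else 0) ∧
      ReflTransGen ((searchMachine I₀ h₀ α).Step B) ⟨10, i, j, x⟩ ⟨47, i, j, x'⟩ := by
  rw [(hT n).1] at hx
  obtain ⟨x₁, hx₁, h9, hr₁⟩ := search_word (g n).2 (hT (n + 1)).2.1 (hT (n + 1)).2.2 _ hx
  obtain ⟨x₂, h0, h1, hr₂⟩ := search_test_success hx₁ h9 h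
  exact ⟨x₂, h0, h1, hr₁.trans hr₂⟩

theorem search_loop_failure
    (hT : ∀ n, T n = blockEncode (g n).2 (T (n + 1)) (g n).1 ∧ 0 ≤ T n ∧ T n < 1)
    {n : ℕ} (hx : LoopRegs X κ 0 (T n) x)
    (h : 0 < hornerEval (g n).1 X * hornerEval (g n).1 X + κ) :
    ∃ x', LoopRegs X κ 0 (T (n + 1)) x' ∧
      TransGen ((searchMachine I₀ h₀ α).Step B) ⟨10, i, j, x⟩ ⟨10, i, j, x'⟩ := by
  rw [(hT n).1] at hx
  obtain ⟨x₁, hx₁, -, hr₁⟩ := search_word (g n).2 (hT (n + 1)).2.1 (hT (n + 1)).2.2 _ hx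
  obtain ⟨x₂, hx₂, hr₂⟩ := search_test_failure hx₁ h
  exact ⟨x₂, hx₂, TransGen.trans_right hr₁ hr₂⟩

theorem search_outputs
    (hT : ∀ n, T n = blockEncode (g n).2 (T (n + 1)) (g n).1 ∧ 0 ≤ T n ∧ T n < 1)
    {z : ℝ} {n : ℕ} (hn : hornerEval (g n).1 z = 0)
    (hlt : ∀ m < n, hornerEval (g m).1 z ≠ 0)
    (hI : (searchMachine I₀ h₀ (T 0)).Step B (start [z]) ⟨4, 1, 1, inputRegs [z]⟩) :
    (searchMachine I₀ h₀ (T 0)).Outputs B [z] [bif (g n).2 then 1 else 0] := by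
  have reach : ∀ m ≤ n, ∃ x', LoopRegs z 0 0 (T m) x' ∧
      ReflTransGen ((searchMachine I₀ h₀ (T 0)).Step B) (start [z]) ⟨10, 1, 1, x'⟩ := by
    intro m hm
    induction m with
    | zero =>
      obtain ⟨x', hx', hr⟩ := search_init (B := B) (I₀ := I₀) (h₀ := h₀) (α := T 0)
        (i := 1) (j := 1) (inputRegs [z])
      exact ⟨x', by simpa [inputRegs] using hx', .head hI hr⟩
    | succ m ih =>
      obtain ⟨x', hx', hr⟩ := ih (by omega)
      obtain ⟨x₂, hx₂, hr₂⟩ := search_loop_failure hT hx'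
        (by simpa using mul_self_pos.2 (hlt m (by omega)))
      exact ⟨x₂, hx₂, hr.trans hr₂.to_reflTransGen⟩
  obtain ⟨x', hx', hr⟩ := reach n le_rfl
  obtain ⟨x₂, h0, h1, hr₂⟩ := search_loop_success hT hx' (by simp [hn])
  exact ⟨_, ⟨hr.trans hr₂, rfl⟩, stores_singleton h0 h1⟩

/-- On inputs of length other than one, `κ > 0` alone makes every test fail. -/
theorem search_not_halts
    (hT : ∀ n, T n = blockEncode (g n).2 (T (n + 1)) (g n).1 ∧ 0 ≤ T n ∧ T n < 1)
    {y : List ℝ} (hy : ∀ z, y = [z] → ∀ n, hornerEval (g n).1 z ≠ 0)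
    (hI : (searchMachine I₀ h₀ (T 0)).Step B (start y) ⟨4, 1, 1, inputRegs y⟩) :
    ¬ (searchMachine I₀ h₀ (T 0)).Halts B y := by
  set X := inputRegs y 1
  set κ := (inputRegs y 0 - 1) * (inputRegs y 0 - 1) with hκ
  have hpos : ∀ n, 0 < hornerEval (g n).1 X * hornerEval (g n).1 X + κ := by
    intro n
    by_cases h1 : y.length = 1
    · obtain ⟨z, rfl⟩ := List.length_eq_one_iff.1 h1
      have := mul_self_pos.2 (hy z rfl n)
      simp only [X, hκ, inputRegs]
      simpa using this
    · have : (y.length : ℝ) - 1 ≠ 0 := sub_ne_zero.2 (by exact_mod_cast h1)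
      exact add_pos_of_nonneg_of_pos (mul_self_nonneg _) (mul_self_pos.2 this)
  refine Machine.not_halts_of_recurrent
    {c | ∃ n x, LoopRegs X κ 0 (T n) x ∧ c = ⟨10, 1, 1, x⟩} ?_ ?_
  · obtain ⟨x', hx', hr⟩ := search_init (B := B) (I₀ := I₀) (h₀ := h₀) (α := T 0)
      (i := 1) (j := 1) (inputRegs y)
    exact ⟨_, ⟨0, x', hx', rfl⟩, .head hI hr⟩
  · rintro _ ⟨n, x, hx, rfl⟩
    obtain ⟨x', hx', hr⟩ := search_loop_failure hT hx (hpos n)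
    exact ⟨_, ⟨n + 1, x', hx', rfl⟩, hr⟩

end Search

end BSS
namespace BSS

open Relation

theorem Stores.unique {x : ℕ → ℝ} {s : ℕ} {y z : List ℝ} (hy : Stores x s y)
    (hz : Stores x s z) : y = z := by
  have hl : y.length = z.length := by exact_mod_cast hy.1.symm.trans hz.1
  exact List.ext_getElem hl fun k h1 h2 => (hy.2 k h1).symm.trans (hz.2 k h2)

theorem stores_inputRegs (y : List ℝ) : Stores (inputRegs y) 0 y := by
  refine ⟨rfl, fun k hk => ?_⟩
  rw [zero_add, add_comm 1 k, inputRegs, List.getD_eq_getElem _ _ hk]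

namespace HornerOp

instance : Countable HornerOp :=
  Function.Injective.countable (f := fun o : HornerOp => match o with
    | mul => 0
    | inc => 1
    | dec => (2 : ℕ)) (by intro a b h; cases a <;> cases b <;> simp_all)

theorem map_eval {R S : Type*} [CommRing R] [CommRing S] (f : R →+* S) (x a : R)
    (o : HornerOp) : f (o.eval x a) = o.eval (f x) (f a) := by
  cases o <;> simp [eval]

end HornerOp

theorem map_hornerEval {R S : Type*} [CommRing R] [CommRing S] (f : R →+* S)
    (w : List HornerOp) (x : R) : f (hornerEval w x) = hornerEval w (f x) := by
  have : ∀ a, f (w.foldl (HornerOp.eval x) a) = w.foldl (HornerOp.eval (f x)) (f a) := by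
    induction w with
    | nil => exact fun a => rfl
    | cons o w ih => exact fun a => by rw [List.foldl_cons, List.foldl_cons, ih, o.map_eval]
  rw [hornerEval, this, map_zero, hornerEval]

/-! ### Integer polynomials as words -/

section Polynomials

open Polynomial

/-- Coefficients are produced by repeated `inc` or `dec`, so three letters suffice. -/
theorem exists_hornerEval_eq (p : ℤ[X]) : ∃ w, hornerEval w (X : ℤ[X]) = p := by
  have hinc : ∀ (n : ℕ) (a : ℤ[X]),
      (List.replicate n HornerOp.inc).foldl (HornerOp.eval X) a = a + n := by
    intro n
    induction n with
    | zero => simp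
    | succ n ih =>
      intro a
      rw [List.replicate_succ, List.foldl_cons, ih, HornerOp.eval]
      push_cast; ring
  have hdec : ∀ (n : ℕ) (a : ℤ[X]),
      (List.replicate n HornerOp.dec).foldl (HornerOp.eval X) a = a - n := by
    intro n
    induction n with
    | zero => simp
    | succ n ih =>
      intro a
      rw [List.replicate_succ, List.foldl_cons, ih, HornerOp.eval]
      push_cast; ring
  induction p using Polynomial.recOnHorner with
  | M0 => exact ⟨[], rfl⟩
  | MC p a _ _ ih =>
    obtain ⟨w, rfl⟩ := ih
    obtain ⟨n, rfl | rfl⟩ := a.eq_nat_or_neg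
    · exact ⟨w ++ List.replicate n .inc, by simp [hornerEval, hinc]⟩
    · exact ⟨w ++ List.replicate n .dec, by simp [hornerEval, hdec, sub_eq_add_neg]⟩
  | MX p _ ih =>
    obtain ⟨w, rfl⟩ := ih
    exact ⟨w ++ [.mul], by simp [hornerEval, HornerOp.eval]⟩

theorem hornerEval_eq_aeval (w : List HornerOp) (z : ℝ) :
    hornerEval w z = aeval z (hornerEval w (X : ℤ[X])) := by
  have := map_hornerEval (aeval (R := ℤ) z).toRingHom w X
  simpa using this.symm

theorem isAlgebraic_of_hornerEval_eq_zero {w : List HornerOp} {z : ℝ}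
    (hw : hornerEval w (X : ℤ[X]) ≠ 0) (hz : hornerEval w z = 0) : IsAlgebraic ℚ z :=
  (IsFractionRing.isAlgebraic_iff ℤ ℚ ℝ).1 ⟨_, hw, by rw [← hornerEval_eq_aeval, hz]⟩

/-- A rational number is a root of a nonzero integer polynomial with rational roots only. -/
theorem exists_word_of_rat (r : ℚ) : ∃ w, hornerEval w (X : ℤ[X]) ≠ 0 ∧
    hornerEval w (r : ℝ) = 0 ∧ ∀ z : ℝ, hornerEval w z = 0 → ∃ s : ℚ, (s : ℝ) = z := by
  obtain ⟨w, hw⟩ := exists_hornerEval_eq (C (r.den : ℤ) * X - C r.num)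
  have hd : (r.den : ℝ) ≠ 0 := by exact_mod_cast r.den_ne_zero
  have hev : ∀ z : ℝ, hornerEval w z = r.den * z - r.num := fun z => by
    rw [hornerEval_eq_aeval, hw]; simp
  have hroot : ∀ z : ℝ, hornerEval w z = 0 ↔ (r : ℝ) = z := fun z => by
    rw [hev, sub_eq_zero, Rat.cast_def, div_eq_iff hd, eq_comm, mul_comm]
  refine ⟨w, fun h0 => ?_, (hroot r).2 rfl, fun z hz => ⟨r, (hroot z).1 hz⟩⟩
  -- The zero polynomial would also vanish at `r + 1`.
  have : ∀ z : ℝ, hornerEval w z = 0 := fun z => by rw [hornerEval_eq_aeval, h0, map_zero]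
  have h1 := (hroot (r + 1)).1 (this _)
  simp at h1

/-- An irrational algebraic number is a root of a nonzero integer polynomial with irrational
roots only. -/
theorem exists_word_of_irrational {x : ℝ} (hx : IsAlgebraic ℚ x)
    (hirr : ¬ ∃ s : ℚ, (s : ℝ) = x) : ∃ w, hornerEval w (X : ℤ[X]) ≠ 0 ∧
    hornerEval w x = 0 ∧ ∀ z : ℝ, hornerEval w z = 0 → ¬ ∃ s : ℚ, (s : ℝ) = z := by
  obtain ⟨b, hbM, hb⟩ := IsLocalization.integerNormalization_spec (nonZeroDivisors ℤ)
    (minpoly ℚ x)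
  set P := IsLocalization.integerNormalization (nonZeroDivisors ℤ) (minpoly ℚ x)
  have hb0 : (b : ℝ) ≠ 0 := by exact_mod_cast nonZeroDivisors.ne_zero hbM
  obtain ⟨w, hw⟩ := exists_hornerEval_eq P
  have hev : ∀ z : ℝ, hornerEval w z = b * aeval z (minpoly ℚ x) := fun z => by
    rw [hornerEval_eq_aeval, hw, ← aeval_map_algebraMap ℚ, hb]
    simp
  have hroot : ∀ z : ℝ, hornerEval w z = 0 ↔ aeval z (minpoly ℚ x) = 0 := fun z => by
    rw [hev, mul_eq_zero, or_iff_right hb0]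
  refine ⟨w, fun h0 => ?_, (hroot x).2 (minpoly.aeval _ _), ?_⟩
  · have h1 := hw ▸ hb
    rw [h0, Polynomial.map_zero] at h1
    have hm := minpoly.ne_zero hx.isIntegral
    rw [Algebra.smul_def] at h1
    rcases mul_eq_zero.1 h1.symm with h | h
    · exact nonZeroDivisors.ne_zero hbM (by simp at h; exact h)
    · exact hm h
  · rintro _ hz ⟨s, rfl⟩
    refine hirr ⟨s, ?_⟩
    have hz := (hroot _).1 hz
    -- A rational root `s` shares the minimal polynomial of `x`, which is then `X - C s` and forces
    -- `x = s`.
    have h1 := minpoly.eq_of_irreducible_of_monic (minpoly.irreducible hx.isIntegral) hz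
      (minpoly.monic hx.isIntegral)
    have h2 : minpoly ℚ (s : ℝ) = X - C s := minpoly.eq_X_sub_C ℝ s
    have h3 := minpoly.aeval ℚ x
    rw [h1, h2] at h3
    exact (sub_eq_zero.1 (by simpa using h3)).symm

/-- Any enumeration of the countable set `S` will do. The zero polynomial is excluded automatically,
having irrational roots. -/
theorem exists_seq_rationals : ∃ g : ℕ → List HornerOp × Bool, ∀ z : ℝ,
    (∃ n, hornerEval (g n).1 z = 0) ↔ ∃ s : ℚ, (s : ℝ) = z := by
  let S : Set (List HornerOp × Bool) :=
    {v | ∀ z : ℝ, hornerEval v.1 z = 0 → ∃ s : ℚ, (s : ℝ) = z}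
  have hne : S.Nonempty := by
    obtain ⟨w, -, -, h⟩ := exists_word_of_rat 0
    exact ⟨(w, true), h⟩
  obtain ⟨g, hg⟩ := (Set.to_countable S).exists_eq_range hne
  refine ⟨g, fun z => ⟨?_, ?_⟩⟩
  · rintro ⟨n, hn⟩
    exact (show g n ∈ S from hg ▸ Set.mem_range_self n) z hn
  · rintro ⟨s, rfl⟩
    obtain ⟨w, -, h0, h⟩ := exists_word_of_rat s
    obtain ⟨n, hn⟩ := (hg ▸ (show (w, true) ∈ S from h) : (w, true) ∈ Set.range g)
    exact ⟨n, by rw [hn]; exact h0⟩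

/-- Each algebraic number is a root of a polynomial of pure type, all real roots rational or all
irrational; the bit records the type. -/
theorem exists_seq_algebraics : ∃ g : ℕ → List HornerOp × Bool,
    (∀ z : ℝ, (∃ n, hornerEval (g n).1 z = 0) ↔ IsAlgebraic ℚ z) ∧
    ∀ n (z : ℝ), hornerEval (g n).1 z = 0 → ((g n).2 = true ↔ ∃ s : ℚ, (s : ℝ) = z) := by
  let S : Set (List HornerOp × Bool) := {v | hornerEval v.1 (X : ℤ[X]) ≠ 0 ∧
    ∀ z : ℝ, hornerEval v.1 z = 0 → (v.2 = true ↔ ∃ s : ℚ, (s : ℝ) = z)}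
  have hrat : ∀ s : ℚ, ∃ v ∈ S, hornerEval v.1 (s : ℝ) = 0 := fun s => by
    obtain ⟨w, h, h0, h'⟩ := exists_word_of_rat s
    exact ⟨(w, true), ⟨h, fun z hz => iff_of_true rfl (h' z hz)⟩, h0⟩
  obtain ⟨g, hg⟩ := (Set.to_countable S).exists_eq_range
    (let ⟨v, hv, _⟩ := hrat 0; ⟨v, hv⟩)
  have hgS : ∀ n, g n ∈ S := fun n => hg ▸ Set.mem_range_self n
  refine ⟨g, fun z => ⟨fun ⟨n, hn⟩ => isAlgebraic_of_hornerEval_eq_zero (hgS n).1 hn,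
    fun hz => ?_⟩, fun n => (hgS n).2⟩
  obtain ⟨v, hv, h0⟩ : ∃ v ∈ S, hornerEval v.1 z = 0 := by
    by_cases h : ∃ s : ℚ, (s : ℝ) = z
    · obtain ⟨s, rfl⟩ := h
      exact hrat s
    · obtain ⟨w, h1, h0, h'⟩ := exists_word_of_irrational hz h
      exact ⟨(w, false), ⟨h1, fun z hz => iff_of_false Bool.false_ne_true (h' z hz)⟩, h0⟩
  rw [hg] at hv
  obtain ⟨n, rfl⟩ := hv
  exact ⟨n, h0⟩

end Polynomials

/-! ### Semi-decision and reduction by search -/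

theorem exists_machine_halts_iff (g : ℕ → List HornerOp × Bool) : ∃ M : Machine, M.OracleFree ∧
    ∀ y, M.Halts ∅ y ↔ ∃ z, y = [z] ∧ ∃ n, hornerEval (g n).1 z = 0 := by
  classical
  obtain ⟨T, hT⟩ := exists_stream g
  refine ⟨searchMachine (.branch 4) rfl (T 0), ?_, fun y => ?_⟩
  · intro I hI
    simp only [searchMachine, searchProg, List.mem_cons, List.not_mem_nil, or_false] at hI
    rcases hI with rfl | rfl | rfl | rfl | rfl | rfl | rfl | rfl | rfl | rfl | rfl | rfl | rfl |
        rfl | rfl | rfl | rfl | rfl | rfl | rfl | rfl | rfl | rfl | rfl | rfl | rfl | rfl | rfl |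
        rfl | rfl | rfl | rfl | rfl | rfl | rfl | rfl | rfl | rfl | rfl | rfl | rfl | rfl | rfl |
        rfl | rfl | rfl | rfl <;> exact id
  · have hI : (searchMachine (.branch 4) rfl (T 0)).Step ∅ (start y) ⟨4, 1, 1, inputRegs y⟩ :=
      step_branch rfl (by simp [inputRegs])
    constructor
    · contrapose
      intro h
      exact search_not_halts hT (fun z hz n hn => h ⟨z, hz, n, hn⟩) hI
    · rintro ⟨z, rfl, h⟩
      obtain ⟨c, hc, -⟩ := search_outputs hT (Nat.find_spec h) (fun m hm => Nat.find_min h hm) hI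
      exact ⟨c, hc⟩

theorem isSemiDecidable_rationals : IsSemiDecidable rationals := by
  obtain ⟨g, hg⟩ := exists_seq_rationals
  obtain ⟨M, hM, h⟩ := exists_machine_halts_iff g
  refine ⟨M, hM, fun y => (h y).trans ⟨?_, ?_⟩⟩
  · rintro ⟨z, rfl, hz⟩
    exact ⟨z, (hg z).1 hz, rfl⟩
  · rintro ⟨z, hz, rfl⟩
    exact ⟨z, rfl, (hg z).2 hz⟩

/-- Needed for ℍ ⋠ ℚ: it exhibits 𝔸 as a section of ℍ. -/
theorem isSemiDecidable_algebraics : IsSemiDecidable algebraics := by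
  obtain ⟨g, hg, -⟩ := exists_seq_algebraics
  obtain ⟨M, hM, h⟩ := exists_machine_halts_iff g
  refine ⟨M, hM, fun y => (h y).trans ⟨?_, ?_⟩⟩
  · rintro ⟨z, rfl, hz⟩
    exact ⟨z, (hg z).1 hz, rfl⟩
  · rintro ⟨z, hz, rfl⟩
    exact ⟨z, rfl, (hg z).2 hz⟩

theorem rationals_subset_algebraics : rationals ⊆ algebraics := by
  rintro _ ⟨_, ⟨r, rfl⟩, rfl⟩
  exact ⟨r, isAlgebraic_algebraMap r, rfl⟩

theorem mem_lang_singleton {S : Set ℝ} {z : ℝ} : [z] ∈ lang S ↔ z ∈ S :=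
  ⟨by rintro ⟨_, h, h'⟩; cases h'; exact h, fun h => ⟨z, h, rfl⟩⟩

theorem reduces_rationals_algebraics : Reduces rationals algebraics := by
  classical
  obtain ⟨g, hg, hb⟩ := exists_seq_algebraics
  obtain ⟨T, hT⟩ := exists_stream g
  refine ⟨searchMachine (.oracle 0 4) rfl (T 0), fun y => ?_⟩
  by_cases hy : y ∈ algebraics
  · obtain ⟨z, hz, rfl⟩ := hy
    have h := (hg z).2 hz
    have := search_outputs (B := algebraics) (I₀ := .oracle 0 4) (h₀ := rfl) hT
      (Nat.find_spec h) (fun m hm => Nat.find_min h hm)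
      (step_oracle rfl ⟨[z], mem_lang_singleton.2 hz, stores_inputRegs _⟩)
    have hr : [z] ∈ rationals ↔ (g (Nat.find h)).2 = true := by
      rw [hb _ z (Nat.find_spec h)]
      exact mem_lang_singleton
    convert this using 1
    cases hgn : (g (Nat.find h)).2 <;> simp [charFn, hr, hgn]
  · have hno : ¬ ∃ v ∈ algebraics, Stores (inputRegs y) 0 v := by
      rintro ⟨v, hv, hs⟩
      exact hy (hs.unique (stores_inputRegs y) ▸ hv)
    have hc : charFn rationals y = [0] := if_neg fun h => hy (rationals_subset_algebraics h)
    rw [hc]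
    refine ⟨⟨47, 1, 1, _⟩, ⟨.head (step_oracle_neg rfl hno) <| .head (step_set rfl) <|
      .head (step_set rfl) <| .head (step_branch rfl ?_) .refl, rfl⟩, stores_singleton ?_ ?_⟩ <;>
      simp

/-! ### Reduction to the Halting Problem -/

/-- Instructions that store the entries of a list in consecutive registers. -/
noncomputable def loadProg : ℕ → List ℝ → List Instr
  | _, [] => []
  | s, e :: w => .set s e :: loadProg (s + 1) w

theorem length_loadProg (s : ℕ) (w : List ℝ) : (loadProg s w).length = w.length := by
  induction w generalizing s with
  | nil => rfl
  | cons e w ih => simp [loadProg, ih]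

theorem target_of_mem_loadProg {I : Instr} {s : ℕ} {w : List ℝ} (h : I ∈ loadProg s w) :
    I.target = none := by
  induction w generalizing s with
  | nil => simp [loadProg] at h
  | cons e w ih =>
    rcases List.mem_cons.1 h with rfl | h
    · rfl
    · exact ih h

/-- The prefix `p` absorbs executed instructions in the induction. Registers outside the window
survive, in particular the length and the input entry placed around the code. -/
theorem reach_loadProg {M : Machine} {B : Set (List ℝ)} {i j : ℕ} (w : List ℝ) (s : ℕ)
    (p q : List Instr) (hM : M.prog = p ++ (loadProg s w ++ q)) (x : ℕ → ℝ) :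
    ∃ x', (∀ k (h : k < w.length), x' (s + k) = w[k]) ∧
      (∀ n, (n < s ∨ s + w.length ≤ n) → x' n = x n) ∧
      ReflTransGen (M.Step B) ⟨p.length, i, j, x⟩ ⟨p.length + w.length, i, j, x'⟩ := by
  induction w generalizing s p x with
  | nil => exact ⟨x, by simp, by simp, .refl⟩
  | cons e w ih =>
    obtain ⟨x', h1, h2, hr⟩ := ih (s + 1) (p ++ [.set s e]) (by rw [hM, loadProg]; simp)
      (Function.update x s e)
    refine ⟨x', ?_, ?_, .head (step_set (s := s) (α := e) ?_) ?_⟩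
    · intro k hk
      cases k with
      | zero => rw [add_zero, h2 s (Or.inl (by omega))]; simp
      | succ k =>
        rw [show s + (k + 1) = s + 1 + k by ring, h1 k (by simpa using hk)]
        simp
    · intro n hn
      simp only [List.length_cons] at hn
      rw [h2 n (by omega), Function.update_of_ne (by omega)]
    · rw [hM, loadProg]; simp
    · simpa [add_assoc, add_comm 1] using hr

/-- The instructions of a machine with oracle the halting problem that asks whether the machine
with code `w` terminates on the input. -/
noncomputable def queryProg (w : List ℝ) : List Instr :=
  [.set 2 w.length, .add 2 2 0, .set (3 + w.length) 0, .add (3 + w.length) (3 + w.length) 1] ++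
    (loadProg 3 w ++
      [.set 0 1, .oracle 2 (4 + w.length + 4), .set 1 0, .branch (4 + w.length + 5), .set 1 1])

theorem length_queryProg (w : List ℝ) : (queryProg w).length = 4 + w.length + 5 := by
  simp [queryProg, length_loadProg]; omega

noncomputable def queryMachine (w : List ℝ) : Machine where
  prog := queryProg w
  target_le := by
    intro I hI b hb
    rw [length_queryProg]
    simp only [queryProg, List.mem_append] at hI
    rcases hI with hI | hI | hI
    · simp only [List.mem_cons, List.not_mem_nil, or_false] at hI
      rcases hI with rfl | rfl | rfl | rfl <;> simp [Instr.target] at hb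
    · simp [target_of_mem_loadProg hI] at hb
    · simp only [List.mem_cons, List.not_mem_nil, or_false] at hI
      rcases hI with rfl | rfl | rfl | rfl | rfl <;> simp [Instr.target] at hb <;> omega

theorem queryProg_getElem? (w : List ℝ) (k : ℕ) : (queryProg w)[4 + w.length + k]? =
    ([.set 0 1, .oracle 2 (4 + w.length + 4), .set 1 0, .branch (4 + w.length + 5),
      .set 1 1] : List Instr)[k]? := by
  rw [queryProg, List.getElem?_append_right (by simp; omega),
    List.getElem?_append_right (by simp [length_loadProg]; omega)]
  congr 1
  simp [length_loadProg]; omega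

/-- A semi-decidable set of sequences of length one is reducible to the halting problem. -/
theorem IsSemiDecidable.reduces_haltingProblem {A : Set (List ℝ)} (hA : IsSemiDecidable A)
    (hA1 : ∀ y ∈ A, y.length = 1) : Reduces A haltingProblem := by
  classical
  obtain ⟨M, hM, hMA⟩ := hA
  set w := M.code with hw
  refine ⟨queryMachine w, fun y => ?_⟩
  obtain ⟨x₁, h2, hX, hr₁⟩ : ∃ x₁ : ℕ → ℝ, x₁ 2 = w.length + y.length ∧
      x₁ (3 + w.length) = y.getD 0 0 ∧
      ReflTransGen ((queryMachine w).Step haltingProblem) (start y) ⟨4, 1, 1, x₁⟩ := by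
    refine ⟨_, ?_, ?_, .head (step_set rfl) <| .head (step_add rfl) <| .head (step_set rfl) <|
      .head (step_add rfl) .refl⟩
    · rw [Function.update_of_ne (by omega), Function.update_of_ne (by omega)]
      simp [inputRegs]
    · rw [Function.update_self, Function.update_self, Function.update_of_ne (by omega),
        Function.update_of_ne (by omega), Function.update_of_ne (by omega)]
      simp [inputRegs]
  obtain ⟨x₂, hcode, hrest, hr₂⟩ := reach_loadProg (M := queryMachine w) (B := haltingProblem)
    (i := 1) (j := 1) w 3 _ _ rfl x₁
  rw [← hrest 2 (Or.inl (by omega))] at h2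
  rw [← hrest _ (Or.inr le_rfl)] at hX
  have hr := (hr₁.trans hr₂).tail
    (step_set (M := queryMachine w) (s := 0) (α := 1) (queryProg_getElem? w 0))
  set x₃ := Function.update x₂ 0 1 with hx₃
  have hx : ∀ n, n ≠ 0 → x₃ n = x₂ n := fun n hn => Function.update_of_ne hn _ _
  have hquery : (∃ v ∈ haltingProblem, Stores x₃ 2 v) ↔ y ∈ A := by
    constructor
    · rintro ⟨v, hv, hlen, hget⟩
      rw [hx 2 (by omega), h2] at hlen
      have hlen : w.length + y.length = v.length := by exact_mod_cast hlen
      have htake : v.take w.length = w := by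
        refine List.ext_getElem (by simp; omega) fun k h1 h2 => ?_
        rw [List.getElem_take, ← hget k (by omega), hx _ (by omega)]
        exact hcode k h2
      rw [← List.take_append_drop w.length v, htake, hw,
        code_append_mem_haltingProblem hM, hMA] at hv
      -- Only the first entry of `y` was placed after the code. This is harmless: the tail of `v`
      -- has as many entries as `y`, and `M` halts only on inputs of length one.
      have hy1 : y.length = 1 := by
        have := hA1 _ hv
        rw [List.length_drop, ← hw] at this
        omega
      obtain ⟨z, rfl⟩ := List.length_eq_one_iff.1 hy1
      have hdrop : v.drop w.length = [z] := by
        refine List.ext_getElem (by simp; omega) fun k h1 h2 => ?_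
        obtain rfl : k = 0 := by simpa using h2
        rw [List.getElem_drop, ← hget _ (by simp at hlen; omega), hx _ (by omega)]
        simpa using hX
      rwa [hdrop] at hv
    · intro hy
      obtain ⟨z, rfl⟩ := List.length_eq_one_iff.1 (hA1 y hy)
      refine ⟨w ++ [z], (code_append_mem_haltingProblem hM _).2 ((hMA _).2 hy), ?_, ?_⟩
      · rw [hx 2 (by omega), h2]; simp
      · intro k hk
        rw [hx _ (by omega)]
        by_cases hkw : k < w.length
        · rw [List.getElem_append_left hkw]
          exact hcode k hkw
        · obtain rfl : k = w.length := by simp at hk; omega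
          simpa using hX
  by_cases hy : y ∈ A
  · rw [charFn, if_pos hy]
    refine ⟨_, ⟨(hr.tail (step_oracle (queryProg_getElem? w 1) (hquery.2 hy))).tail
      (step_set (s := 1) (α := 1) (queryProg_getElem? w 4)), (length_queryProg w).symm⟩,
      stores_singleton ?_ ?_⟩ <;> simp [x₃]
  · rw [charFn, if_neg hy]
    refine ⟨_, ⟨((hr.tail (step_oracle_neg (queryProg_getElem? w 1) (mt hquery.1 hy))).tail
      (step_set (s := 1) (α := 0) (queryProg_getElem? w 2))).tail
      (step_branch (queryProg_getElem? w 3) ?_), (length_queryProg w).symm⟩,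
      stores_singleton ?_ ?_⟩ <;> simp [x₃]

theorem reduces_empty (B : Set (List ℝ)) : Reduces ∅ B := by
  refine ⟨⟨[.set 0 1, .set 1 0], by simp [Instr.target]⟩, fun y => ?_⟩
  rw [charFn, if_neg (Set.notMem_empty y)]
  refine ⟨_, ⟨.head (step_set rfl) <| .head (step_set rfl) .refl, rfl⟩,
    stores_singleton ?_ ?_⟩ <;> simp

/-! ### Non-reducibility -/

open Filter Topology

theorem not_mem_lang {S : Set ℝ} {z : ℝ} (h : z ∉ S) : [z] ∉ lang S :=
  mt mem_lang_singleton.1 h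

/-- No machine decides the rationals without a nontrivial oracle. -/
theorem not_reduces_rationals_empty : ¬ Reduces rationals ∅ := by
  rintro ⟨M, hM⟩
  obtain ⟨E, t, hE, hw, ht⟩ := exists_generic M []
  have htr : [t] ∉ rationals := not_mem_lang (by
    rintro ⟨r, rfl⟩
    exact Transcendental.rat_of_subfield ht (isAlgebraic_algebraMap r))
  -- The empty oracle is stable along every filter, so the rationals near `t` may be used directly.
  let l := 𝓝[Set.range ((↑) : ℚ → ℝ)] t
  have : l.NeBot := mem_closure_iff_nhdsWithin_neBot.1 (Rat.denseRange_cast t)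
  have h0 : M.Outputs ∅ [t] [0] := by simpa [charFn, htr] using hM [t]
  have hev := eventually_outputs_zero hE ht nhdsWithin_le_nhds (oracleStable_empty E t l) hw h0
  obtain ⟨a, ha, har⟩ := (hev.and self_mem_nhdsWithin).exists
  have h1 : M.Outputs ∅ [a] [1] := by
    have := hM [a]
    rwa [charFn, if_pos (show [a] ∈ rationals from mem_lang_singleton.2 har)] at this
  exact Machine.outputs_one_zero h1 ha

/-- A set whose sections are the algebraic numbers is not reducible to the rationals. -/
theorem not_reduces_rationals_of_section {A : Set (List ℝ)} (w : List ℝ)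
    (hA : ∀ a : ℝ, w ++ [a] ∈ A ↔ IsAlgebraic ℚ a) : ¬ Reduces A rationals := by
  rintro ⟨M, hM⟩
  obtain ⟨E, t, hE, hw, ht⟩ := exists_generic M w
  have h0 : M.Outputs rationals (w ++ [t]) [0] := by
    have := hM (w ++ [t])
    rwa [charFn, if_neg (mt (hA t).1 (Transcendental.rat_of_subfield ht))] at this
  have hev := eventually_outputs_zero hE ht (algebraicNhds_le t) (oracleStable_rationals ht) hw h0
  obtain ⟨a, ha, har⟩ := (hev.and (eventually_isAlgebraic t)).exists
  have h1 := hM (w ++ [a])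
  rw [charFn, if_pos ((hA a).2 har)] at h1
  exact Machine.outputs_one_zero h1 ha

theorem not_reduces_algebraics_rationals : ¬ Reduces algebraics rationals :=
  not_reduces_rationals_of_section [] fun _ => mem_lang_singleton

theorem not_reduces_haltingProblem_rationals : ¬ Reduces haltingProblem rationals := by
  obtain ⟨M, hM, h⟩ := isSemiDecidable_algebraics
  refine not_reduces_rationals_of_section M.code fun a => ?_
  rw [code_append_mem_haltingProblem hM, h]
  exact mem_lang_singleton

/-- Termination at `t` alone persists to nearby algebraic numbers of large degree; the output plays
no role. -/
theorem not_semiDecidableIn_transcendentals :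
    ¬ SemiDecidableIn (lang Set.univ) transcendentals rationals := by
  rintro ⟨M, hM⟩
  obtain ⟨E, t, hE, hw, ht⟩ := exists_generic M []
  have h0 : M.Halts rationals [t] :=
    (hM _ (mem_lang_singleton.2 trivial)).2
      (mem_lang_singleton.2 (Transcendental.rat_of_subfield ht))
  have hev := eventually_halts hE ht (algebraicNhds_le t) (oracleStable_rationals ht) hw h0
  obtain ⟨a, ha, har⟩ := (hev.and (eventually_isAlgebraic t)).exists
  exact mem_lang_singleton.1 ((hM _ (mem_lang_singleton.2 trivial)).1 ha) har

theorem not_isDecidable_rationals : ¬ IsDecidable rationals := fun ⟨M, _, hM⟩ =>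
  not_reduces_rationals_empty ⟨M, hM⟩

end BSS

theorem theorem1 :
    BSS.StrictlyReduces BSS.rationals BSS.algebraics ∧
    ¬ BSS.SemiDecidableIn (BSS.lang Set.univ) BSS.transcendentals BSS.rationals ∧
    BSS.IsSemiDecidable BSS.rationals ∧
    ¬ BSS.IsDecidable BSS.rationals ∧
    BSS.StrictlyReduces ∅ BSS.rationals ∧
    BSS.StrictlyReduces BSS.rationals BSS.haltingProblem :=
  ⟨⟨BSS.reduces_rationals_algebraics, BSS.not_reduces_algebraics_rationals⟩,
    BSS.not_semiDecidableIn_transcendentals, BSS.isSemiDecidable_rationals,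
    BSS.not_isDecidable_rationals,
    ⟨BSS.reduces_empty _, BSS.not_reduces_rationals_empty⟩,
    ⟨BSS.isSemiDecidable_rationals.reduces_haltingProblem
      (by rintro _ ⟨z, -, rfl⟩; rfl), BSS.not_reduces_haltingProblem_rationals⟩⟩
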